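/- **Conventions.** Trees are total binary trees $t:\{\mathtt L,\mathtt R\}^*\to A$ over a finite alphabet $A$. An alternating automaton $\mathcal A=\langle A,Q,\delta,\Omega\rangle$ (without exits) has finite sets $A$ of letters and $Q$ of states, priorities $\Omega:Q\to\mathbb N$ and transitions $\delta(q,a)$ built by the grammar $b::=\top\mid\bot\mid(q,d)\mid b\vee b\mid b\wedge b$ with $q\in Q$, $d\in\{\mathtt L,\mathtt R\}$. $L(\mathcal A,q_I)$ is the set of trees $t$ such that $\exists$ has a winning strategy in the usual acceptance parity game on $t$ from $q_I$ ($\exists$ resolves $\vee$, $\forall$ resolves $\wedge$, and $\exists$ wins a play iff the least priority occurring infinitely often is even; $\top$ is immediate acceptance and $\bot$ immediate rejection). $\mathcal A$ is * *deterministic* if every transition has the form $\top$, $\bot$, $(q_d,d)$ or $(q_{\mathtt L},\mathtt L)\wedge(q_{\mathtt R},\mathtt R)$; * *non-deterministic* if every transition is a (multifold) disjunction of such transitions; * a *game automaton* if every transition has the form $\top$, $\bot$, $(q_d,d)$, $(q_{\mathtt L},\mathtt L)\vee(q_{\mathtt R},\mathtt R)$ or $(q_{\mathtt L},\mathtt L)\wedge(q_{\mathtt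 R},\mathtt R)$; * *of index $(i,j)$* if $i$ is the minimal and $j$ the maximal priority of its states, where $\top$ and $\bot$, if they occur in transitions, are counted as additional states of some even and some odd priority, respectively. For a game automaton $\mathcal A$, a tree $t$ and a state $q_I$, the *run* $\rho$ labels the nodes of $t$ by elements of $Q\cup\{\top,\bot,\ast\}$: $\rho(\varepsilon)=q_I$; if $\rho(v)=q\in Q$ and $b=\delta(q,t(v))$, then $\rho(v\mathtt L)=q_{\mathtt L}$, $\rho(v\mathtt R)=q_{\mathtt R}$ for branching $b$; $\rho(vd)=q_d$ and the other child is labelled $\ast$ for $b=(q_d,d)$; both children are labelled $b$ for $b\in\{\top,\bot\}$; and if $\rho(v)\notin Q$, both children are labelled $\ast$. The *run game* is played on the nodes not labelled $\ast$, from the root along the child relation, with loops on nodes labelled $\top$ or $\bot$; the priority of $v$ is $\Omega(\rho(v))$ with $\Omega(\top)=0$, $\Omega(\bot)=1$, and $v$ belongs to $\exists$ iff $\rho(v)\in Q$ and $\delta(\rho(v),t(v))$ is a disjunction $(q_{\mathtt L},\mathtt L)\vee(q_{\mathtt R},\mathtt R)$. A tree $s$ over $\{\mathtt L,\mathtt R,\star\}$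 *encodes* a strategy $\sigma$ of $\exists$ in the run game if for every node $v$ with $\rho(v)\in Q$ that is visited by some play conforming to $\sigma$: $s(v)\in\{\mathtt L,\mathtt R\}$ and $\sigma(v)=v\cdot s(v)$ if $v$ belongs to $\exists$, and $s(v)=\star$ otherwise. **Proposition.** There is an algorithm (a computable function on finite presentations of automata) which, given a game automaton $\mathcal A$ over an alphabet $A$ and a state $q_I^{\mathcal A}$, constructs a deterministic automaton $\mathcal D$ over the alphabet $A\times\{\mathtt L,\mathtt R,\star\}$ and a state $q_I^{\mathcal D}$ such that: 1. for all $i,j\in\mathbb N$, $L(\mathcal A,q_I^{\mathcal A})$ is recognized by a non-deterministic automaton of index $(i,j)$ if and only if $L(\mathcal D,q_I^{\mathcal D})$ is recognized by a non-deterministic automaton of index $(i,j)$; 2. if every state $q$ of $\mathcal A$ is non-trivial (that is, $L(\mathcal A,q)$ is neither empty nor the set of all trees), then $L(\mathcal D,q_I^{\mathcal D})$ is the set of all trees $t\otimes s$, where $(t\otimes s)(v)=(t(v),s(v))$, such that $s$ encodes a winning strategy of $\exists$ in the run game of $\mathcal A$ on $t$ from $q_I^{\mathcal A}$. -/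

import Mathlib

namespace TreeAut

/-! ## Trees -/

/-- The two directions of the binary tree. -/
inductive Dir : Type
  | L
  | R

instance : DecidableEq Dir := fun a b =>
  match a, b with
  | .L, .L => isTrue rfl
  | .R, .R => isTrue rfl
  | .L, .R => isFalse (fun h => by cases h)
  | .R, .L => isFalse (fun h => by cases h)

/-- A total tree over `Λ`. A node is the word of directions leading to it from the root, so the
child of `v` in direction `d` is `v ++ [d]`. -/
abbrev InfTree (Λ : Type) : Type := List Dir → Λ

/-! ## Parity games -/

/-- A parity game without final positions. -/
structure ParityGame (V : Type) where
  /-- the positions that belong to `∃`; the others belong to `∀` -/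
  existsPos : Set V
  start : V
  edge : V → V → Prop
  priority : V → ℕ

namespace ParityGame

variable {V : Type} (G : ParityGame V)

/-- In the absence of final positions all plays are infinite. -/
def IsPlay (π : ℕ → V) : Prop :=
  π 0 = G.start ∧ ∀ k, G.edge (π k) (π (k + 1))

/-- The least priority that occurs infinitely often (the `liminf`) is even. -/
def WonByExists (π : ℕ → V) : Prop :=
  ∃ e, Even e ∧ IsLeast {p | ∃ᶠ k in Filter.atTop, G.priority (π k) = p} e

/-- A positional strategy for `∃`; the values outside of `∃`'s positions are irrelevant. -/
def IsStrategy (σ : V → V) : Prop :=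
  ∀ v ∈ G.existsPos, G.edge v (σ v)

def Conforms (σ : V → V) (π : ℕ → V) : Prop :=
  ∀ k, π k ∈ G.existsPos → π (k + 1) = σ (π k)

/-- `σ` is a winning strategy for `∃`. -/
def IsWinning (σ : V → V) : Prop :=
  G.IsStrategy σ ∧ ∀ π, G.IsPlay π → G.Conforms σ π → G.WonByExists π

/-- The positions that occur in `σ` viewed as a tree. -/
def Visits (σ : V → V) (v : V) : Prop :=
  ∃ π, G.IsPlay π ∧ G.Conforms σ π ∧ ∃ k, π k = v

end ParityGame

/-! ## Alternating automata -/

/-- Transitions of alternating automata with states `Q`. -/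
inductive Formula (Q : Type) : Type
  | top : Formula Q
  | bot : Formula Q
  | atom : Q → Dir → Formula Q
  | or : Formula Q → Formula Q → Formula Q
  | and : Formula Q → Formula Q → Formula Q

namespace Formula

variable {Q : Type}

/-- `⊤` occurs in the formula. -/
def UsesTop : Formula Q → Prop
  | top => True
  | bot => False
  | atom _ _ => False
  | or b c => UsesTop b ∨ UsesTop c
  | and b c => UsesTop b ∨ UsesTop c

/-- `⊥` occurs in the formula. -/
def UsesBot : Formula Q → Prop
  | top => False
  | bot => True
  | atom _ _ => False
  | or b c => UsesBot b ∨ UsesBot c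
  | and b c => UsesBot b ∨ UsesBot c

/-- `(q_L, L) ∨ (q_R, R)` -/
def orLR (q r : Q) : Formula Q := or (atom q .L) (atom r .R)

/-- `(q_L, L) ∧ (q_R, R)` -/
def andLR (q r : Q) : Formula Q := and (atom q .L) (atom r .R)

/-- The transitions allowed in game automata. -/
def IsGame (b : Formula Q) : Prop :=
  b = top ∨ b = bot ∨ (∃ q d, b = atom q d) ∨ (∃ q r, b = orLR q r) ∨ (∃ q r, b = andLR q r)

/-- The transitions allowed in deterministic automata. -/
def IsDeterministic (b : Formula Q) : Prop :=
  b = top ∨ b = bot ∨ (∃ q d, b = atom q d) ∨ (∃ q r, b = andLR q r)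

/-- Multifold disjunctions of deterministic transitions. -/
inductive IsNondeterministic : Formula Q → Prop
  | det {b : Formula Q} : b.IsDeterministic → IsNondeterministic b
  | or {b c : Formula Q} :
      IsNondeterministic b → IsNondeterministic c → IsNondeterministic (or b c)

/-- Formulas over the states `0, …, n - 1` written as words in prefix (Polish) notation. -/
def code {n : ℕ} : Formula (Fin n) → List ℕ
  | top => [0]
  | bot => [1]
  | atom q .L => [2, q]
  | atom q .R => [3, q]
  | or b c => 4 :: (code b ++ code c)
  | and b c => 5 :: (code b ++ code c)

end Formula

/-- A (total) alternating automaton on trees over the alphabet `Λ`, with states `Q`. Both are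
finite wherever automata are used. The initial state is a parameter of the language. -/
structure Automaton (Λ Q : Type) where
  δ : Q → Λ → Formula Q
  priority : Q → ℕ

/-- Positions of the acceptance game: a node with a state, or a node with a formula. (Formulas
that are not subformulas of transitions are never reached.) -/
inductive Position (Q : Type) : Type
  | state : List Dir → Q → Position Q
  | formula : List Dir → Formula Q → Position Q

/-- The labels of runs of game automata; `star` is the label `∗` of nodes that are not visited. -/
inductive RunLabel (Q : Type) : Type
  | state : Q → RunLabel Q
  | top : RunLabel Q
  | bot : RunLabel Q
  | star : RunLabel Q

/-- Finite presentations of automata: the number of letters, the initial state, and for each state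
its priority and the list of its transitions. -/
abbrev AutCode : Type := ℕ × ℕ × List (ℕ × List (List ℕ))

namespace Automaton

variable {Λ Q : Type} (A : Automaton Λ Q)

/-- The edges of the acceptance game on the tree `t`. -/
inductive Move (t : InfTree Λ) : Position Q → Position Q → Prop
  | top (v : List Dir) : Move t (.formula v .top) (.formula v .top)
  | bot (v : List Dir) : Move t (.formula v .bot) (.formula v .bot)
  | or_left (v : List Dir) (b c : Formula Q) : Move t (.formula v (.or b c)) (.formula v b)
  | or_right (v : List Dir) (b c : Formula Q) : Move t (.formula v (.or b c)) (.formula v c)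
  | and_left (v : List Dir) (b c : Formula Q) : Move t (.formula v (.and b c)) (.formula v b)
  | and_right (v : List Dir) (b c : Formula Q) : Move t (.formula v (.and b c)) (.formula v c)
  | atom (v : List Dir) (q : Q) (d : Dir) :
      Move t (.formula v (.atom q d)) (.state (v ++ [d]) q)
  | unfold (v : List Dir) (q : Q) : Move t (.state v q) (.formula v (A.δ q (t v)))

/-- The priorities in the acceptance game. The supremum is the maximal priority of a state, as
there are finitely many states. -/
noncomputable def positionPriority : Position Q → ℕ
  | .state _ q => A.priority q
  | .formula _ .top => 0
  | .formula _ .bot => 1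
  | .formula _ (.atom _ _) => ⨆ q, A.priority q
  | .formula _ (.or _ _) => ⨆ q, A.priority q
  | .formula _ (.and _ _) => ⨆ q, A.priority q

/-- The acceptance game of `A` on `t` from the state `q`. -/
noncomputable def acceptanceGame (t : InfTree Λ) (q : Q) : ParityGame (Position Q) where
  existsPos := {x | ∃ v b c, x = .formula v (.or b c)}
  start := .state [] q
  edge := A.Move t
  priority := A.positionPriority

/-- The language recognized from the state `q`. -/
def lang (q : Q) : Set (InfTree Λ) :=
  {t | ∃ σ, (A.acceptanceGame t q).IsWinning σ}

/-- A state is non-trivial if it accepts some tree, but not all trees. -/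
def IsNontrivial (q : Q) : Prop := A.lang q ≠ ∅ ∧ A.lang q ≠ Set.univ

def IsGame : Prop := ∀ q a, (A.δ q a).IsGame

def IsDeterministic : Prop := ∀ q a, (A.δ q a).IsDeterministic

def IsNondeterministic : Prop := ∀ q a, (A.δ q a).IsNondeterministic

/-- The priorities in use when `⊤` and `⊥`, if they occur in transitions, are counted as
additional looping states of priorities `e` and `o`. -/
def usedPriorities (e o : ℕ) : Set ℕ :=
  Set.range A.priority ∪ {p | p = e ∧ ∃ q a, (A.δ q a).UsesTop} ∪
    {p | p = o ∧ ∃ q a, (A.δ q a).UsesBot}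

/-- `A` is an `(i, j)`-automaton: `i` is the minimal and `j` the maximal priority, where `⊤` and
`⊥` count as additional looping states of some even and some odd priority. -/
def HasIndex (i j : ℕ) : Prop :=
  ∃ e o, Even e ∧ Odd o ∧ IsLeast (A.usedPriorities e o) i ∧ IsGreatest (A.usedPriorities e o) j

/-! ### Runs of game automata -/

/-- The label of the child in direction `d` of a node with run label `x` and letter `a`. The last
clause concerns transitions that do not occur in game automata. -/
def nextLabel (x : RunLabel Q) (a : Λ) (d : Dir) : RunLabel Q :=
  match x with
  | .state q =>
    match A.δ q a with
    | .top => .top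
    | .bot => .bot
    | .atom r d' => if d = d' then .state r else .star
    | .or (.atom r .L) (.atom r' .R) => match d with
      | .L => .state r
      | .R => .state r'
    | .and (.atom r .L) (.atom r' .R) => match d with
      | .L => .state r
      | .R => .state r'
    | _ => .star
  | _ => .star

/-- The labels of the run on `t` whose root is labelled with `x`. -/
def runFrom : InfTree Λ → RunLabel Q → List Dir → RunLabel Q
  | _, x, [] => x
  | t, x, d :: v => runFrom (fun w => t (d :: w)) (A.nextLabel x (t []) d) v

/-- The run of `A` on `t` from the state `q`. -/
def run (t : InfTree Λ) (q : Q) : List Dir → RunLabel Q := A.runFrom t (.state q)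

theorem runFrom_concat (t : InfTree Λ) (x : RunLabel Q) (v : List Dir) (d : Dir) :
    A.runFrom t x (v ++ [d]) = A.nextLabel (A.runFrom t x v) (t v) d := by
  induction v generalizing t x with
  | nil => rfl
  | cons c v ih => exact ih (fun w => t (c :: w)) (A.nextLabel x (t []) c)

/-- The run is determined by `run_nil` and `run_concat`. -/
theorem run_nil (t : InfTree Λ) (q : Q) : A.run t q [] = .state q := rfl

theorem run_concat (t : InfTree Λ) (q : Q) (v : List Dir) (d : Dir) :
    A.run t q (v ++ [d]) = A.nextLabel (A.run t q v) (t v) d :=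
  A.runFrom_concat t (.state q) v d

/-- The priority of a run label; nodes labelled `∗` are not positions of the run game. -/
def labelPriority : RunLabel Q → ℕ
  | .state q => A.priority q
  | .top => 0
  | .bot => 1
  | .star => 0

/-- The run game of `A` on `t` from `q`. Its positions are the nodes that the run does not label
with `∗` (the other nodes have no edges), its edges follow the child relation, and there are loops
on the nodes labelled with `⊤` or `⊥`. -/
def runGame (t : InfTree Λ) (q : Q) : ParityGame (List Dir) where
  existsPos := {v | ∃ r q₁ q₂, A.run t q v = .state r ∧ A.δ r (t v) = .orLR q₁ q₂}
  start := []
  edge v w :=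
    (A.run t q v ≠ .star ∧ A.run t q w ≠ .star ∧ ∃ d, w = v ++ [d]) ∨
      ((A.run t q v = .top ∨ A.run t q v = .bot) ∧ w = v)
  priority v := A.labelPriority (A.run t q v)

/-- `s` encodes the strategy `σ` for `∃` in the run game, viewed as a subtree of `t`: in the nodes
of this subtree that carry a state of `A`, `s` gives the direction chosen by `σ` if the node belongs
to `∃`, and the letter `⋆` (here `none`) if it does not. -/
def Encodes (t : InfTree Λ) (q : Q) (s : InfTree (Option Dir)) (σ : List Dir → List Dir) : Prop :=
  ∀ v r, (A.runGame t q).Visits σ v → A.run t q v = .state r →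
    (v ∈ (A.runGame t q).existsPos → ∃ d, s v = some d ∧ σ v = v ++ [d]) ∧
    (v ∉ (A.runGame t q).existsPos → s v = none)

/-- The set of trees `t ⊗ s` such that `s` encodes a winning strategy for `∃` in the run game of
`A` on `t` from `q`. -/
def winningStrategies (q : Q) : Set (InfTree (Λ × Option Dir)) :=
  {u | ∃ σ, (A.runGame (fun v => (u v).1) q).IsWinning σ ∧
    A.Encodes (fun v => (u v).1) q (fun v => (u v).2) σ}

/-! ### Finite presentations -/

/-- The finite presentation of an automaton with states `0, …, n - 1` and initial state `q`, where
`letters` lists the letters of the alphabet. -/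
def code {n : ℕ} (A : Automaton Λ (Fin n)) (letters : List Λ) (q : Fin n) : AutCode :=
  (letters.length, q,
    List.ofFn fun r => (A.priority r, letters.map fun a => (A.δ r a).code))

end Automaton

/-- The letters of the alphabet `{0, …, m - 1} × {L, R, ⋆}`. -/
def strategyLetters (m : ℕ) : List (Fin m × Option Dir) :=
  (List.finRange m).flatMap fun a => [(a, some Dir.L), (a, some Dir.R), (a, none)]

/-- `M` is recognized by a non-deterministic automaton of index `(i, j)`. -/
def NondetRecognizable {Λ : Type} (M : Set (InfTree Λ)) (i j : ℕ) : Prop :=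
  ∃ (Q : Type) (_ : Finite Q) (B : Automaton Λ Q) (p : Q),
    B.IsNondeterministic ∧ B.HasIndex i j ∧ B.lang p = M

end TreeAut

/-! The automaton `D` is `A.strat U`: on a letter `(a, x)` it follows the transition of `A` on `a`
and lets `x` make the choice of `∃`, so that its run is forced. Here `U` is the set of states
accepting all trees; transitions from such states, and disjunctions offering one of them, become
`⊤`. If `U` is empty, `D` checks exactly that the second component encodes a winning strategy
(`lang_strat_eq_winningStrategies`).

For the index, one direction is projection: `A` accepts `t` iff `D` accepts `t ⊗ s` for some `s`
(`lang_eq_image_strat`), and a non-deterministic automaton can guess `s`. Conversely, let `B`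
recognize the language of `A`. For each state `r` outside `U` fix a tree `τ r` rejected from `r`.
Given `u = t ⊗ s`, replace in `t` every subtree that `s` tells `∃` not to enter by a tree rejected
from the state awaiting her there, and put `τ r` wherever `D` rejects in state `r`. On the resulting
tree `cut` she gains nothing by deviating from `s`, so `A` accepts it iff `D` accepts `u`
(`cut_mem_lang_iff`). This is why `U` needs special treatment: a universal state rejects no tree.
Whether `B` accepts a fixed tree from a given state is a single bit, so a product of `B` and `D`
reading `u` can simulate `B` on the cut tree and move to an accepting or rejecting sink where a
fixed tree begins (`mem_lang_simulate_iff`). Sinks of both parities fit between `i` and `j` if `i <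
j`; if `i = j`, the language of `A` is empty or full, and that of `D` is its preimage under
projection.

It remains to compute `U`. Universality is a game in which `∀` also picks the letters, and it is
decided by the first cycle that a play closes (`lang_eq_univ_iff_of_stack`). A player who wins this
finite game wins the parity game by keeping a stack of states and cutting out each closed cycle
(`evenLiminf_of_stack`). If `∀` wins, the letters he picks form a tree accepted by the dual
automaton.

Acceptance is always handled through runs with at most one state in each node (`mem_lang_iff`). They
exist because game automata and non-deterministic automata have linear transitions: no conjunction
sends two states in the same direction. Runs may stop where acceptance is already known
(`mem_lang_of_partial`). -/

namespace TreeAut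

open Filter

/-! ## The parity condition -/

/-- The least number that `f` takes infinitely often is even. -/
def EvenLiminf (f : ℕ → ℕ) : Prop :=
  ∃ e, Even e ∧ IsLeast {p | ∃ᶠ k in atTop, f k = p} e

theorem frequently_shift (f : ℕ → ℕ) (N p : ℕ) :
    (∃ᶠ k in atTop, f (N + k) = p) ↔ ∃ᶠ k in atTop, f k = p := by
  simp only [Filter.frequently_atTop]
  constructor
  · intro h a
    obtain ⟨b, hb, e⟩ := h a
    exact ⟨N + b, by omega, e⟩
  · intro h a
    obtain ⟨b, hb, e⟩ := h (N + a)
    exact ⟨b - N, by omega, by rwa [Nat.add_sub_cancel' (by omega)]⟩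

theorem evenLiminf_shift (f : ℕ → ℕ) (N : ℕ) :
    EvenLiminf (fun k => f (N + k)) ↔ EvenLiminf f := by
  simp only [EvenLiminf, frequently_shift]

theorem evenLiminf_const (c : ℕ) : EvenLiminf (fun _ => c) ↔ Even c := by
  have : {p | ∃ᶠ _ in (atTop : Filter ℕ), c = p} = {c} := by
    ext p; simp [eq_comm]
  rw [EvenLiminf, this]
  constructor
  · rintro ⟨e, he, h, -⟩
    rwa [Set.mem_singleton_iff.1 h] at he
  · exact fun h => ⟨c, h, isLeast_singleton⟩

theorem exists_frequently_eq {f : ℕ → ℕ} {M : ℕ} (hf : ∀ k, f k ≤ M) :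
    ∃ p, ∃ᶠ k in atTop, f k = p := by
  by_contra! h
  have h' : ∀ p ∈ Set.Iic M, ∀ᶠ k in atTop, f k ≠ p := fun p _ => by
    simpa [Filter.Frequently] using h p
  rw [← Filter.eventually_all_finite (Set.finite_Iic M)] at h'
  obtain ⟨k, hk⟩ := h'.exists
  exact hk (f k) (hf k) rfl

/-- A bounded sequence has recurring values, hence a least one; the right-hand side says that no odd
value can be the least. -/
theorem evenLiminf_iff {f : ℕ → ℕ} {M : ℕ} (hf : ∀ k, f k ≤ M) :
    EvenLiminf f ↔ ∀ p, Odd p → (∃ᶠ k in atTop, f k = p) →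
      ∃ p' < p, ∃ᶠ k in atTop, f k = p' := by
  classical
  constructor
  · rintro ⟨e, he, h1, h2⟩ p hp hfp
    refine ⟨e, lt_of_le_of_ne (h2 hfp) ?_, h1⟩
    rintro rfl
    exact Nat.not_even_iff_odd.2 hp he
  · intro h
    have hex := exists_frequently_eq hf
    refine ⟨Nat.find hex, ?_, Nat.find_spec hex, fun p hp => Nat.find_min' hex hp⟩
    by_contra ho
    obtain ⟨p', h1, h2⟩ := h _ (Nat.not_even_iff_odd.1 ho) (Nat.find_spec hex)
    exact Nat.find_min hex h1 h2

/-- Passing from the priorities `f` of a play to the subsequence `g` of priorities of states, when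
the other priorities dominate those of the states. -/
theorem evenLiminf_subsequence {f g : ℕ → ℕ} {M : ℕ} (hg : ∀ i, g i ≤ M)
    (h1 : ∀ i, ∃ k ≥ i, f k = g i)
    (h2 : ∀ N, ∃ K, ∀ k ≥ K, M ≤ f k ∨ ∃ i ≥ N, f k = g i) :
    EvenLiminf f ↔ EvenLiminf g := by
  have hsub : ∀ p, (∃ᶠ k in atTop, g k = p) → ∃ᶠ k in atTop, f k = p := by
    intro p hp
    rw [Filter.frequently_atTop] at hp ⊢
    intro a
    obtain ⟨i, hi, e⟩ := hp a
    obtain ⟨k, hk, e'⟩ := h1 i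
    exact ⟨k, le_trans hi hk, e'.trans e⟩
  have hdom : ∀ p, (∃ᶠ k in atTop, f k = p) → ∃ p' ≤ p, ∃ᶠ k in atTop, g k = p' := by
    intro p hp
    by_cases hM : M ≤ p
    · obtain ⟨p', hp'⟩ := exists_frequently_eq hg
      obtain ⟨k, hk⟩ := hp'.exists
      exact ⟨p', (hk ▸ hg k).trans hM, hp'⟩
    · refine ⟨p, le_rfl, ?_⟩
      rw [Filter.frequently_atTop] at hp ⊢
      intro N
      obtain ⟨K, hK⟩ := h2 N
      obtain ⟨k, hk, e⟩ := hp K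
      rcases hK k hk with h | ⟨i, hi, e'⟩
      · omega
      · exact ⟨i, hi, e'.symm.trans e⟩
  refine exists_congr fun e => and_congr_right fun _ => ?_
  constructor
  · rintro ⟨a, b⟩
    obtain ⟨p', h3, h4⟩ := hdom e a
    have : p' = e := le_antisymm h3 (b (hsub _ h4))
    exact ⟨this ▸ h4, fun p hp => b (hsub _ hp)⟩
  · rintro ⟨a, b⟩
    refine ⟨hsub _ a, fun p hp => ?_⟩
    obtain ⟨p', h3, h4⟩ := hdom p hp
    exact (b h4).trans h3

/-! ## Branches, subtrees, and labellings defined from the root -/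

/-- The prefix of length `k` of the branch `π`. -/
def pre (π : ℕ → Dir) (k : ℕ) : List Dir := (List.range k).map π

@[simp] theorem pre_zero (π : ℕ → Dir) : pre π 0 = [] := rfl

theorem pre_succ (π : ℕ → Dir) (k : ℕ) : pre π (k + 1) = pre π k ++ [π k] := by
  simp [pre, List.range_succ]

/-- The subtree of `t` at the node `v`. -/
def sub {Λ : Type} (t : InfTree Λ) (v : List Dir) : InfTree Λ := fun w => t (v ++ w)

@[simp] theorem sub_nil {Λ : Type} (t : InfTree Λ) : sub t [] = t := rfl

theorem sub_sub {Λ : Type} (t : InfTree Λ) (v w : List Dir) : sub (sub t v) w = sub t (v ++ w) := by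
  funext x; simp [sub]

@[simp] theorem sub_apply_nil {Λ : Type} (t : InfTree Λ) (v : List Dir) : sub t v [] = t v := by
  simp [sub]

/-- The labelling of the nodes in which the label of a child is computed from its parent. -/
def unfold {S : Type} (step : List Dir → S → Dir → S) (s : S) (v : List Dir) : S :=
  (v.foldl (fun x d => (x.1 ++ [d], step x.1 x.2 d)) (([] : List Dir), s)).2

@[simp] theorem unfold_nil {S : Type} (step : List Dir → S → Dir → S) (s : S) :
    unfold step s [] = s := rfl

theorem unfold_concat {S : Type} (step : List Dir → S → Dir → S) (s : S) (v : List Dir) (d : Dir) :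
    unfold step s (v ++ [d]) = step v (unfold step s v) d := by
  have h : ∀ (w u : List Dir) (s : S),
      (w.foldl (fun x d => (x.1 ++ [d], step x.1 x.2 d)) (u, s)).1 = u ++ w := by
    intro w
    induction w with
    | nil => simp
    | cons c w ih => intro u s; simp [ih]
  simp [unfold, List.foldl_append, h]

/-! ## Satisfaction of formulas -/

namespace Formula

variable {Q P : Type}

/-- Satisfaction of `b` by the set `X` of atoms. -/
def Sat (X : Q → Dir → Prop) : Formula Q → Prop
  | top => True
  | bot => False
  | atom q d => X q d
  | or b c => Sat X b ∨ Sat X c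
  | and b c => Sat X b ∧ Sat X c

theorem Sat.mono {X Y : Q → Dir → Prop} (h : ∀ q d, X q d → Y q d) :
    ∀ {b : Formula Q}, b.Sat X → b.Sat Y
  | top, _ => trivial
  | atom _ _, hb => h _ _ hb
  | or _ _, hb => hb.imp (Sat.mono h) (Sat.mono h)
  | and _ _, hb => ⟨Sat.mono h hb.1, Sat.mono h hb.2⟩

/-- Some atom of the formula leads in direction `d`. -/
def HasDir (d : Dir) : Formula Q → Prop
  | top => False
  | bot => False
  | atom _ d' => d' = d
  | or b c => HasDir d b ∨ HasDir d c
  | and b c => HasDir d b ∨ HasDir d c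

/-- The two parts of a conjunction lead in different directions. -/
def Linear : Formula Q → Prop
  | top => True
  | bot => True
  | atom _ _ => True
  | or b c => Linear b ∧ Linear c
  | and b c => Linear b ∧ Linear c ∧ ∀ d, ¬(b.HasDir d ∧ c.HasDir d)

theorem IsGame.linear {b : Formula Q} (h : b.IsGame) : b.Linear := by
  rcases h with rfl | rfl | ⟨q, d, rfl⟩ | ⟨q, r, rfl⟩ | ⟨q, r, rfl⟩ <;>
    simp [Linear, orLR, andLR, HasDir]

theorem IsDeterministic.isGame {b : Formula Q} (h : b.IsDeterministic) : b.IsGame := by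
  rcases h with h | h | h | h
  · exact .inl h
  · exact .inr (.inl h)
  · exact .inr (.inr (.inl h))
  · exact .inr (.inr (.inr (.inr h)))

theorem IsNondeterministic.linear {b : Formula Q} (h : b.IsNondeterministic) : b.Linear := by
  induction h with
  | det h => exact h.isGame.linear
  | or _ _ h1 h2 => exact ⟨h1, h2⟩

/-- A satisfied linear formula is satisfied by choosing at most one atom in each direction. -/
theorem Linear.exists_choice {X : Q → Dir → Prop} {b : Formula Q} (hl : b.Linear) (hb : b.Sat X) :
    ∃ g : Dir → Option Q, (∀ q d, g d = some q → X q d ∧ b.HasDir d) ∧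
      b.Sat (fun q d => g d = some q) := by
  induction b with
  | top => exact ⟨fun _ => none, by simp, trivial⟩
  | bot => exact hb.elim
  | atom q d =>
    refine ⟨fun d' => if d' = d then some q else none, ?_, by simp [Sat]⟩
    intro q' d' h
    by_cases hd : d' = d
    · subst hd
      simp only [if_true, Option.some.injEq] at h
      subst h
      exact ⟨hb, rfl⟩
    · simp [hd] at h
  | or b c ihb ihc =>
    rcases hb with hb | hb
    · obtain ⟨g, h1, h2⟩ := ihb hl.1 hb
      exact ⟨g, fun q d h => ⟨(h1 q d h).1, .inl (h1 q d h).2⟩, .inl h2⟩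
    · obtain ⟨g, h1, h2⟩ := ihc hl.2 hb
      exact ⟨g, fun q d h => ⟨(h1 q d h).1, .inr (h1 q d h).2⟩, .inr h2⟩
  | and b c ihb ihc =>
    obtain ⟨g, h1, h2⟩ := ihb hl.1 hb.1
    obtain ⟨g', h1', h2'⟩ := ihc hl.2.1 hb.2
    refine ⟨fun d => (g d).or (g' d), ?_, ?_, ?_⟩
    · intro q d h
      dsimp only at h
      rcases hg : g d with _ | p
      · rw [hg, Option.none_or] at h
        exact ⟨(h1' q d h).1, .inr (h1' q d h).2⟩
      · rw [hg, Option.some_or, Option.some.injEq] at h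
        subst h
        exact ⟨(h1 p d hg).1, .inl (h1 p d hg).2⟩
    · exact h2.mono fun q d h => by simp [h]
    · refine h2'.mono fun q d h => ?_
      change (g d).or (g' d) = some q
      rcases hg : g d with _ | p
      · rw [Option.none_or, h]
      · exact (hl.2.2 d ⟨(h1 p d hg).2, (h1' q d h).2⟩).elim

/-- Renaming of states depending on the direction. -/
def map (f : Q → Dir → P) : Formula Q → Formula P
  | top => top
  | bot => bot
  | atom q d => atom (f q d) d
  | or b c => or (map f b) (map f c)
  | and b c => and (map f b) (map f c)

theorem sat_map {f : Q → Dir → P} {X : P → Dir → Prop} {b : Formula Q} :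
    (b.map f).Sat X ↔ b.Sat (fun q d => X (f q d) d) := by
  induction b with
  | top | bot | atom => rfl
  | or b c ihb ihc => exact or_congr ihb ihc
  | and b c ihb ihc => exact and_congr ihb ihc

theorem IsNondeterministic.map {f : Q → Dir → P} {b : Formula Q} (h : b.IsNondeterministic) :
    (b.map f).IsNondeterministic := by
  induction h with
  | det h =>
    refine .det ?_
    rcases h with rfl | rfl | ⟨q, d, rfl⟩ | ⟨q, r, rfl⟩
    · exact .inl rfl
    · exact .inr (.inl rfl)
    · exact .inr (.inr (.inl ⟨_, _, rfl⟩))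
    · exact .inr (.inr (.inr ⟨_, _, rfl⟩))
  | or _ _ h1 h2 => exact .or h1 h2

end Formula

/-! ### Plays through a reachable position -/

namespace ParityGame

variable {V : Type} (G : ParityGame V)

/-- The positions that a play conforming to `σ` reaches after finitely many moves. -/
inductive Reach (σ : V → V) : V → Prop
  | start : Reach σ G.start
  | step {x y : V} : Reach σ x → G.edge x y → (x ∈ G.existsPos → y = σ x) → Reach σ y

variable {G}

/-- The continuation `c` is generalized, so that the induction can prepend the positions before `x`
one at a time. -/
theorem Reach.exists_play {σ : V → V} {x : V} (hx : G.Reach σ x) {c : ℕ → V} (h0 : c 0 = x)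
    (hedge : ∀ k, G.edge (c k) (c (k + 1))) (hconf : G.Conforms σ c) :
    ∃ π N, G.IsPlay π ∧ G.Conforms σ π ∧ ∀ k, π (N + k) = c k := by
  induction hx generalizing c with
  | start => exact ⟨c, 0, ⟨h0, hedge⟩, hconf, fun k => by rw [Nat.zero_add]⟩
  | @step x y hx he hσ ih =>
    obtain ⟨π, N, h1, h2, h3⟩ := ih (c := fun k => Nat.casesOn k x c) rfl
      (fun k => by cases k with
        | zero => simpa [h0] using he
        | succ k => exact hedge k)
      (fun k hk => by cases k with
        | zero => simpa [h0] using hσ hk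
        | succ k => exact hconf k hk)
    exact ⟨π, N + 1, h1, h2, fun k => by rw [Nat.add_assoc, Nat.add_comm 1]; exact h3 (k + 1)⟩

theorem IsWinning.evenLiminf {σ : V → V} (hw : G.IsWinning σ) {x : V} (hx : G.Reach σ x)
    {c : ℕ → V} (h0 : c 0 = x) (hedge : ∀ k, G.edge (c k) (c (k + 1)))
    (hconf : G.Conforms σ c) : EvenLiminf (fun k => G.priority (c k)) := by
  obtain ⟨π, N, h1, h2, h3⟩ := hx.exists_play h0 hedge hconf
  have h4 : EvenLiminf (fun k => G.priority (π k)) := hw.2 π h1 h2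
  rw [← evenLiminf_shift _ N] at h4
  simpa only [h3] using h4

end ParityGame

/-! ### Accepting runs of linear automata -/

namespace Automaton

variable {Λ Q : Type} (A : Automaton Λ Q)

/-- All transitions are linear: in the acceptance game, `∃` can fix the state in each node. -/
def IsLinear : Prop := ∀ q a, (A.δ q a).Linear

variable {A}

theorem IsGame.isLinear (h : A.IsGame) : A.IsLinear := fun q a => (h q a).linear

theorem IsDeterministic.isLinear (h : A.IsDeterministic) : A.IsLinear :=
  fun q a => (h q a).isGame.linear

theorem IsNondeterministic.isLinear (h : A.IsNondeterministic) : A.IsLinear :=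
  fun q a => (h q a).linear

variable (A)

/-- `ρ` is an accepting run of `A` on `t` from `q` with at most one state in each node. -/
structure IsRun (t : InfTree Λ) (q : Q) (ρ : List Dir → Option Q) : Prop where
  root : ρ [] = some q
  sat : ∀ v p, ρ v = some p → (A.δ p (t v)).Sat (fun q' d => ρ (v ++ [d]) = some q')
  parity : ∀ (v : List Dir) (π : ℕ → Dir) (s : ℕ → Q), (∀ k, ρ (v ++ pre π k) = some (s k)) →
    EvenLiminf (fun k => A.priority (s k))

variable {A}

theorem IsRun.sub {t : InfTree Λ} {q : Q} {ρ : List Dir → Option Q} (h : A.IsRun t q ρ)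
    {v : List Dir} {p : Q} (hv : ρ v = some p) :
    A.IsRun (TreeAut.sub t v) p (fun w => ρ (v ++ w)) where
  root := by simpa using hv
  sat w r hw := by simpa [TreeAut.sub, List.append_assoc] using h.sat (v ++ w) r hw
  parity w π s hs := h.parity (v ++ w) π s (by simpa [List.append_assoc] using hs)

theorem priority_le_iSup [Finite Q] (A : Automaton Λ Q) (q : Q) : A.priority q ≤ ⨆ q, A.priority q :=
  le_ciSup (Set.finite_range A.priority).bddAbove q

/-! ### From winning strategies to runs -/

/-- From the formula `b` in the node `v`, the strategy `σ` of `∃` allows to reach the atom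
`(q, d)`. -/
def Selects (σ : Position Q → Position Q) (v : List Dir) : Formula Q → Q → Dir → Prop
  | .top, _, _ => False
  | .bot, _, _ => False
  | .atom q' d', q, d => q = q' ∧ d = d'
  | .or b c, q, d =>
    (σ (.formula v (.or b c)) = .formula v b ∧ Selects σ v b q d) ∨
      (σ (.formula v (.or b c)) = .formula v c ∧ Selects σ v c q d)
  | .and b c, q, d => Selects σ v b q d ∨ Selects σ v c q d

theorem Selects.hasDir {σ : Position Q → Position Q} {v : List Dir} {q : Q} {d : Dir} :
    ∀ {b : Formula Q}, Selects σ v b q d → b.HasDir d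
  | .atom _ _, h => h.2.symm
  | .or _ _, h => h.imp (fun h => Selects.hasDir h.2) (fun h => Selects.hasDir h.2)
  | .and _ _, h => h.imp Selects.hasDir Selects.hasDir

/-- At a disjunction `σ` picks one side, unless both sides are the same formula; at a conjunction,
linearity leaves only one side that leads in direction `d`. -/
theorem Selects.unique {σ : Position Q → Position Q} {v : List Dir} {q q' : Q} {d : Dir}
    {b : Formula Q} (hl : b.Linear) (h : Selects σ v b q d) (h' : Selects σ v b q' d) :
    q = q' := by
  induction b with
  | top => exact h.elim
  | bot => exact h.elim
  | atom => exact h.1.trans h'.1.symm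
  | or b c ihb ihc =>
    rcases h with ⟨e, h⟩ | ⟨e, h⟩ <;> rcases h' with ⟨e', h'⟩ | ⟨e', h'⟩
    · exact ihb hl.1 h h'
    · rw [e] at e'
      injection e' with _ e'
      exact ihc hl.2 (e' ▸ h) h'
    · rw [e] at e'
      injection e' with _ e'
      exact ihb hl.1 (e' ▸ h) h'
    · exact ihc hl.2 h h'
  | and b c ihb ihc =>
    rcases h with h | h <;> rcases h' with h' | h'
    · exact ihb hl.1 h h'
    · exact (hl.2.2 d ⟨h.hasDir, h'.hasDir⟩).elim
    · exact (hl.2.2 d ⟨h'.hasDir, h.hasDir⟩).elim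
    · exact ihc hl.2.1 h h'

section

variable {t : InfTree Λ} {q : Q} {σ : Position Q → Position Q}

theorem notMem_existsPos_of_ne {x : Position Q} (h : ∀ v b c, x ≠ .formula v (.or b c)) :
    x ∉ (A.acceptanceGame t q).existsPos := by
  rintro ⟨v, b, c, e⟩
  exact h v b c e

theorem strategy_or (hσ : (A.acceptanceGame t q).IsStrategy σ) (v : List Dir) (b c : Formula Q) :
    σ (.formula v (.or b c)) = .formula v b ∨ σ (.formula v (.or b c)) = .formula v c := by
  have h : A.Move t (.formula v (.or b c)) (σ (.formula v (.or b c))) := hσ _ ⟨v, b, c, rfl⟩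
  generalize σ (.formula v (.or b c)) = y at h
  cases h
  · exact .inl rfl
  · exact .inr rfl

/-- The only obstacle is `⊥`, and reaching it would give a conforming play that loops at priority
`1`. -/
theorem sat_selects (hw : (A.acceptanceGame t q).IsWinning σ) {v : List Dir} {b : Formula Q}
    (hr : (A.acceptanceGame t q).Reach σ (.formula v b)) : b.Sat (Selects σ v b) := by
  induction b with
  | top => trivial
  | bot =>
    have := hw.evenLiminf hr (c := fun _ => .formula v .bot) rfl (fun _ => Move.bot v)
      (fun k hk => (notMem_existsPos_of_ne (by simp) hk).elim)
    exact absurd ((evenLiminf_const 1).1 this) (by decide)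
  | atom p d => exact ⟨rfl, rfl⟩
  | or b c ihb ihc =>
    rcases strategy_or hw.1 v b c with h | h
    · exact .inl ((ihb (hr.step (Move.or_left v b c) fun _ => h.symm)).mono
        fun _ _ hs => .inl ⟨h, hs⟩)
    · exact .inr ((ihc (hr.step (Move.or_right v b c) fun _ => h.symm)).mono
        fun _ _ hs => .inr ⟨h, hs⟩)
  | and b c ihb ihc =>
    have hn := notMem_existsPos_of_ne (A := A) (t := t) (q := q)
      (x := .formula v (.and b c)) (by simp)
    exact ⟨(ihb (hr.step (Move.and_left v b c) fun h => (hn h).elim)).mono fun _ _ hs => .inl hs,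
      (ihc (hr.step (Move.and_right v b c) fun h => (hn h).elim)).mono fun _ _ hs => .inr hs⟩

theorem reach_of_selects {v : List Dir} {b : Formula Q} {p : Q} {d : Dir}
    (hr : (A.acceptanceGame t q).Reach σ (.formula v b)) (hs : Selects σ v b p d) :
    (A.acceptanceGame t q).Reach σ (.state (v ++ [d]) p) := by
  induction b with
  | top => exact hs.elim
  | bot => exact hs.elim
  | atom p' d' =>
    obtain ⟨rfl, rfl⟩ := hs
    exact hr.step (Move.atom v p d) fun h => (notMem_existsPos_of_ne (by simp) h).elim
  | or b c ihb ihc =>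
    rcases hs with ⟨e, hs⟩ | ⟨e, hs⟩
    · exact ihb (hr.step (Move.or_left v b c) fun _ => e.symm) hs
    · exact ihc (hr.step (Move.or_right v b c) fun _ => e.symm) hs
  | and b c ihb ihc =>
    have hn := notMem_existsPos_of_ne (A := A) (t := t) (q := q)
      (x := .formula v (.and b c)) (by simp)
    rcases hs with hs | hs
    · exact ihb (hr.step (Move.and_left v b c) fun h => (hn h).elim) hs
    · exact ihc (hr.step (Move.and_right v b c) fun h => (hn h).elim) hs

end

open Classical in
/-- The next position when `∃` follows `σ` and `∀` follows the branch `π` with states `s`; the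
number counts the states that were passed. -/
noncomputable def branchStep (A : Automaton Λ Q) (t : InfTree Λ) (σ : Position Q → Position Q)
    (π : ℕ → Dir) (s : ℕ → Q) : ℕ × Position Q → ℕ × Position Q
  | (i, .state v p) => (i, .formula v (A.δ p (t v)))
  | (i, .formula v .top) => (i, .formula v .top)
  | (i, .formula v .bot) => (i, .formula v .bot)
  | (i, .formula v (.atom p d)) => (i + 1, .state (v ++ [d]) p)
  | (i, .formula v (.or b c)) => (i, σ (.formula v (.or b c)))
  | (i, .formula v (.and b c)) =>
    if Selects σ v b (s (i + 1)) (π i) then (i, .formula v b) else (i, .formula v c)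

/-- Along a branch selected by a winning strategy the parity condition holds. -/
theorem evenLiminf_of_selects [Finite Q] {t : InfTree Λ} {q : Q} {σ : Position Q → Position Q}
    (hw : (A.acceptanceGame t q).IsWinning σ) {v : List Dir} {π : ℕ → Dir} {s : ℕ → Q}
    (hr : (A.acceptanceGame t q).Reach σ (.state v (s 0)))
    (hs : ∀ k, Selects σ (v ++ pre π k) (A.δ (s k) (t (v ++ pre π k))) (s (k + 1)) (π k)) :
    EvenLiminf (fun k => A.priority (s k)) := by
  classical
  let f := branchStep A t σ π s
  let c : ℕ → ℕ × Position Q := fun k => f^[k] (0, .state v (s 0))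
  let Inv : ℕ × Position Q → Prop := fun x =>
    x.2 = .state (v ++ pre π x.1) (s x.1) ∨
      ∃ b, x.2 = .formula (v ++ pre π x.1) b ∧ Selects σ (v ++ pre π x.1) b (s (x.1 + 1)) (π x.1)
  have hstep : ∀ x, Inv x → Inv (f x) ∧ A.Move t x.2 (f x).2 ∧
      (x.2 ∈ (A.acceptanceGame t q).existsPos → (f x).2 = σ x.2) ∧
      x.1 ≤ (f x).1 ∧ (f x).1 ≤ x.1 + 1 := by
    rintro ⟨i, x⟩ (h | ⟨b, h, hb⟩) <;> dsimp only at h <;> subst h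
    · exact ⟨.inr ⟨_, rfl, hs i⟩, Move.unfold _ _,
        fun h => (notMem_existsPos_of_ne (by simp) h).elim, le_rfl, Nat.le_succ _⟩
    · cases b with
      | top => exact hb.elim
      | bot => exact hb.elim
      | atom p d =>
        obtain ⟨h1, h2⟩ := hb
        dsimp only at h1 h2
        refine ⟨.inl ?_, Move.atom _ _ _,
          fun h => (notMem_existsPos_of_ne (by simp) h).elim, Nat.le_succ _, le_rfl⟩
        simp [f, branchStep, pre_succ, h1, h2]
      | or b c =>
        rcases hb with ⟨e, hb⟩ | ⟨e, hb⟩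
        · refine ⟨.inr ⟨b, e, hb⟩, ?_, fun _ => rfl, le_rfl, Nat.le_succ _⟩
          change A.Move t _ (σ (.formula (v ++ pre π i) (.or b c)))
          rw [e]
          exact Move.or_left _ _ _
        · refine ⟨.inr ⟨c, e, hb⟩, ?_, fun _ => rfl, le_rfl, Nat.le_succ _⟩
          change A.Move t _ (σ (.formula (v ++ pre π i) (.or b c)))
          rw [e]
          exact Move.or_right _ _ _
      | and b c =>
        dsimp only at hb
        by_cases hsel : Selects σ (v ++ pre π i) b (s (i + 1)) (π i)
        · have e : f (i, .formula (v ++ pre π i) (.and b c)) = (i, .formula (v ++ pre π i) b) := by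
            simp [f, branchStep, hsel]
          rw [e]
          exact ⟨.inr ⟨b, rfl, hsel⟩, Move.and_left _ _ _,
            fun h => (notMem_existsPos_of_ne (by simp) h).elim, le_rfl, Nat.le_succ _⟩
        · have e : f (i, .formula (v ++ pre π i) (.and b c)) = (i, .formula (v ++ pre π i) c) := by
            simp [f, branchStep, hsel]
          rw [e]
          exact ⟨.inr ⟨c, rfl, hb.resolve_left hsel⟩, Move.and_right _ _ _,
            fun h => (notMem_existsPos_of_ne (by simp) h).elim, le_rfl, Nat.le_succ _⟩
  have hc : ∀ k, c (k + 1) = f (c k) := fun k => Function.iterate_succ_apply' f k _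
  have hInv : ∀ k, Inv (c k) := by
    intro k
    induction k with
    | zero => left; simp [c]
    | succ k ih => rw [hc]; exact (hstep _ ih).1
  have hwon := hw.evenLiminf hr (c := fun k => (c k).2) rfl
    (fun k => by rw [hc]; exact (hstep _ (hInv k)).2.1)
    (fun k hk => by dsimp only; rw [hc]; exact (hstep _ (hInv k)).2.2.1 hk)
  -- At most `k` states are passed in `k` moves, so the `i`-th state of the branch appears no
  -- earlier than at time `i`.
  have hidx : ∀ k, (c k).1 ≤ k := by
    intro k
    induction k with
    | zero => exact le_rfl
    | succ k ih => rw [hc]; exact ((hstep _ (hInv k)).2.2.2.2).trans (Nat.succ_le_succ ih)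
  have hmono : Monotone fun k => (c k).1 :=
    monotone_nat_of_le_succ fun k => by rw [hc]; exact (hstep _ (hInv k)).2.2.2.1
  -- from a formula, the next state is reached
  have hnext : ∀ i b k, c k = (i, .formula (v ++ pre π i) b) →
      Selects σ (v ++ pre π i) b (s (i + 1)) (π i) →
      ∃ k', c k' = (i + 1, .state (v ++ pre π (i + 1)) (s (i + 1))) := by
    intro i b
    induction b with
    | top => intro k _ h; exact h.elim
    | bot => intro k _ h; exact h.elim
    | atom p d =>
      rintro k hk ⟨h1, h2⟩
      exact ⟨k + 1, by rw [hc, hk]; simp [f, branchStep, pre_succ, h1, h2]⟩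
    | or b c ihb ihc =>
      rintro k hk (⟨e, h⟩ | ⟨e, h⟩)
      · exact ihb (k + 1) (by rw [hc, hk]; simp [f, branchStep, e]) h
      · exact ihc (k + 1) (by rw [hc, hk]; simp [f, branchStep, e]) h
    | and b c ihb ihc =>
      intro k hk h
      by_cases hsel : Selects σ (v ++ pre π i) b (s (i + 1)) (π i)
      · exact ihb (k + 1) (by rw [hc, hk]; simp [f, branchStep, hsel]) hsel
      · exact ihc (k + 1) (by rw [hc, hk]; simp [f, branchStep, hsel]) (h.resolve_left hsel)
  have hT : ∀ i, ∃ k, c k = (i, .state (v ++ pre π i) (s i)) := by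
    intro i
    induction i with
    | zero => exact ⟨0, by simp [c]⟩
    | succ i ih =>
      obtain ⟨k, hk⟩ := ih
      exact hnext i _ (k + 1) (by rw [hc, hk]; rfl) (hs i)
  -- The formulas met by this play contain a selected atom, so they are not `⊤` or `⊥`; they have
  -- the maximal priority and do not affect the parity condition.
  refine (evenLiminf_subsequence (M := ⨆ q, A.priority q) (fun i => A.priority_le_iSup _)
    (fun i => ?_) (fun N => ?_)).1 hwon
  · obtain ⟨k, hk⟩ := hT i
    refine ⟨k, ?_, ?_⟩
    · simpa [hk] using hidx k
    · rw [hk]; rfl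
  · obtain ⟨K, hK⟩ := hT N
    refine ⟨K, fun k hk => ?_⟩
    have hN : N ≤ (c k).1 := by simpa [hK] using hmono hk
    rcases hInv k with h | ⟨b, h, hb⟩
    · exact .inr ⟨_, hN, by rw [h]; rfl⟩
    · left
      rw [h]
      cases b with
      | top => exact hb.elim
      | bot => exact hb.elim
      | atom | or | and => exact le_rfl

-- The children of a labelled node receive the states that `σ` selects. By linearity there is at
-- most one in each direction, so each branch of labels comes from a play conforming to `σ`.
open Classical in
theorem exists_isRun [Finite Q] (hA : A.IsLinear) {t : InfTree Λ} {q : Q} (ht : t ∈ A.lang q) :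
    ∃ ρ, A.IsRun t q ρ := by
  obtain ⟨σ, hw⟩ := ht
  let ρ : List Dir → Option Q := unfold (fun v s d => s.bind fun p =>
    if h : ∃ q', Selects σ v (A.δ p (t v)) q' d then some h.choose else none) (some q)
  have hρ : ∀ v d q', ρ (v ++ [d]) = some q' ↔
      ∃ p, ρ v = some p ∧ Selects σ v (A.δ p (t v)) q' d := by
    intro v d q'
    simp only [ρ, unfold_concat, Option.bind_eq_some_iff]
    refine exists_congr fun p => and_congr_right fun _ => ?_
    constructor
    · intro h
      split_ifs at h with he
      · rw [Option.some.injEq] at h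
        exact h ▸ he.choose_spec
    · intro h
      have he : ∃ q', Selects σ v (A.δ p (t v)) q' d := ⟨q', h⟩
      rw [dif_pos he, Option.some.injEq]
      exact he.choose_spec.unique (hA _ _) h
  have hreach : ∀ v p, ρ v = some p → (A.acceptanceGame t q).Reach σ (.state v p) := by
    intro v
    induction v using List.reverseRecOn with
    | nil =>
      intro p h
      obtain rfl : q = p := by simpa [ρ] using h
      exact .start
    | append_singleton v d ih =>
      intro p h
      obtain ⟨p', h1, h2⟩ := (hρ v d p).1 h
      exact reach_of_selects ((ih p' h1).step (Move.unfold v p')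
        fun h => (notMem_existsPos_of_ne (by simp) h).elim) h2
  refine ⟨ρ, rfl, fun v p h => ?_, fun v π s hs => ?_⟩
  · exact (sat_selects hw ((hreach v p h).step (Move.unfold v p)
      fun h => (notMem_existsPos_of_ne (by simp) h).elim)).mono
      fun q' d hq => (hρ v d q').2 ⟨p, h, hq⟩
  · refine evenLiminf_of_selects hw (v := v) (π := π) (hreach v _ (by simpa using hs 0)) fun k => ?_
    have h := hs (k + 1)
    rw [pre_succ, ← List.append_assoc, hρ] at h
    obtain ⟨p, h1, h2⟩ := h
    rw [hs k, Option.some.injEq] at h1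
    exact h1 ▸ h2

end Automaton

namespace Automaton

variable {Λ Q : Type} {A : Automaton Λ Q}

/-! ### From runs to winning strategies -/

open Classical in
/-- The strategy for `∃` that is read off from a run. -/
noncomputable def runStrategy (ρ : List Dir → Option Q) : Position Q → Position Q
  | .formula v (.or b c) =>
    if b.Sat (fun q d => ρ (v ++ [d]) = some q) then .formula v b else .formula v c
  | x => x

/-- `∃` always moves to a disjunct satisfied by the labels of the children. Then the formulas in a
play remain satisfied, and the states in it are those along a branch of `ρ`. -/
theorem IsRun.mem_lang [Finite Q] {t : InfTree Λ} {q : Q} {ρ : List Dir → Option Q}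
    (h : A.IsRun t q ρ) : t ∈ A.lang q := by
  classical
  let X : List Dir → Q → Dir → Prop := fun v q d => ρ (v ++ [d]) = some q
  refine ⟨runStrategy ρ, ?_, ?_⟩
  · rintro _ ⟨v, b, c, rfl⟩
    by_cases hb : b.Sat (X v)
    · have e : runStrategy ρ (.formula v (.or b c)) = .formula v b := if_pos hb
      rw [e]; exact Move.or_left v b c
    · have e : runStrategy ρ (.formula v (.or b c)) = .formula v c := if_neg hb
      rw [e]; exact Move.or_right v b c
  rintro x ⟨hx0, hx⟩ hconf
  change ∀ k, A.Move t (x k) (x (k + 1)) at hx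
  change EvenLiminf fun k => A.positionPriority (x k)
  -- the run labels the states in the play, and satisfies its formulas
  have hor : ∀ k v b c, x k = .formula v (.or b c) → (Formula.or b c).Sat (X v) →
      (x (k + 1) = .formula v b ∧ b.Sat (X v)) ∨ (x (k + 1) = .formula v c ∧ c.Sat (X v)) := by
    intro k v b c hk hs
    have e := hconf k ⟨v, b, c, hk⟩
    rw [hk] at e
    by_cases hb : b.Sat (X v)
    · exact .inl ⟨e.trans (if_pos hb), hb⟩
    · exact .inr ⟨e.trans (if_neg hb), hs.resolve_left hb⟩
  have hstate : ∀ k v p, x k = .state v p → x (k + 1) = .formula v (A.δ p (t v)) := by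
    intro k v p hk
    have := hx k
    rw [hk] at this
    generalize x (k + 1) = y at this
    cases this
    rfl
  by_cases htop : ∃ k v, x k = .formula v .top
  · obtain ⟨k, v, hk⟩ := htop
    have hj : ∀ j, x (k + j) = .formula v .top := by
      intro j
      induction j with
      | zero => exact hk
      | succ j ih =>
        have := hx (k + j)
        rw [ih] at this
        rw [← add_assoc]
        generalize x (k + j + 1) = y at this
        cases this
        rfl
    rw [← evenLiminf_shift _ k]
    simp only [hj]
    exact (evenLiminf_const 0).2 (by decide)
  push Not at htop
  -- A satisfied formula is not `⊥`, and `⊤` is now excluded, so the play reaches a labelled child,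
  -- passing only through positions of maximal priority.
  have hnext : ∀ b k v, x k = .formula v b → b.Sat (X v) → ∃ k' > k, ∃ d q',
      x k' = .state (v ++ [d]) q' ∧ ρ (v ++ [d]) = some q' ∧
      ∀ i, k ≤ i → i < k' → (⨆ q, A.priority q) ≤ A.positionPriority (x i) := by
    intro b
    have hext : ∀ {b : Formula Q} {k v}, x k = .formula v b →
        (⨆ q, A.priority q) ≤ A.positionPriority (.formula v b) →
        (∃ k' > k + 1, ∃ d q', x k' = .state (v ++ [d]) q' ∧ ρ (v ++ [d]) = some q' ∧
          ∀ i, k + 1 ≤ i → i < k' → (⨆ q, A.priority q) ≤ A.positionPriority (x i)) →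
        ∃ k' > k, ∃ d q', x k' = .state (v ++ [d]) q' ∧ ρ (v ++ [d]) = some q' ∧
          ∀ i, k ≤ i → i < k' → (⨆ q, A.priority q) ≤ A.positionPriority (x i) := by
      rintro b k v hk hp ⟨k', h1, d, q', h2, h3, h4⟩
      refine ⟨k', by omega, d, q', h2, h3, fun i hi hi' => ?_⟩
      rcases hi.eq_or_lt with rfl | hi
      · rwa [hk]
      · exact h4 i hi hi'
    induction b with
    | top => exact fun k v hk _ => (htop k v hk).elim
    | bot => exact fun k v _ hs => hs.elim
    | atom p d =>
      intro k v hk hs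
      have := hx k
      rw [hk] at this
      refine ⟨k + 1, Nat.lt_succ_self k, d, p, ?_, hs, fun i hi hi' => ?_⟩
      · generalize x (k + 1) = y at this
        cases this
        rfl
      · obtain rfl : i = k := by omega
        rw [hk]
        exact le_rfl
    | or b c ihb ihc =>
      intro k v hk hs
      refine hext hk le_rfl ?_
      rcases hor k v b c hk hs with ⟨h1, h2⟩ | ⟨h1, h2⟩
      · exact ihb _ _ h1 h2
      · exact ihc _ _ h1 h2
    | and b c ihb ihc =>
      intro k v hk hs
      refine hext hk le_rfl ?_
      have := hx k
      rw [hk] at this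
      generalize hy : x (k + 1) = y at this
      cases this
      · exact ihb _ _ hy hs.1
      · exact ihc _ _ hy hs.2
  -- the subsequence of the states
  let Y := {y : ℕ × List Dir × Q // x y.1 = .state y.2.1 y.2.2 ∧ ρ y.2.1 = some y.2.2}
  have hY : ∀ y : Y, ∃ z : Y, y.1.1 < z.1.1 ∧ (∃ d, z.1.2.1 = y.1.2.1 ++ [d]) ∧
      ∀ i, y.1.1 < i → i < z.1.1 → (⨆ q, A.priority q) ≤ A.positionPriority (x i) := by
    rintro ⟨⟨k, v, p⟩, h1, h2⟩
    obtain ⟨k', h3, d, q', h4, h5, h6⟩ := hnext _ (k + 1) v (hstate k v p h1) (h.sat v p h2)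
    exact ⟨⟨(k', v ++ [d], q'), h4, h5⟩, (Nat.lt_succ_self k).trans h3, ⟨d, rfl⟩, h6⟩
  choose nxt hn1 hn2 hn3 using hY
  choose dir hdir using hn2
  let y : ℕ → Y := fun i => nxt^[i] ⟨(0, [], q), hx0, h.root⟩
  have hy : ∀ i, y (i + 1) = nxt (y i) := fun i => Function.iterate_succ_apply' nxt i _
  have hnode : ∀ i, (y i).1.2.1 = pre (fun i => dir (y i)) i := by
    intro i
    induction i with
    | zero => rfl
    | succ i ih => rw [hy, hdir, ih, pre_succ]
  have hpar := h.parity [] (fun i => dir (y i)) (fun i => (y i).1.2.2) fun k => by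
    rw [List.nil_append, ← hnode]; exact (y k).2.2
  have hlt : ∀ i, (y i).1.1 < (y (i + 1)).1.1 := fun i => by rw [hy]; exact hn1 _
  have hprio : ∀ i, A.positionPriority (x (y i).1.1) = A.priority (y i).1.2.2 :=
    fun i => by rw [(y i).2.1]; rfl
  refine (evenLiminf_subsequence (M := ⨆ q, A.priority q) (fun i => A.priority_le_iSup _)
    (fun i => ⟨(y i).1.1, ?_, hprio i⟩) (fun N => ⟨(y N).1.1, fun k hk => ?_⟩)).2 hpar
  · exact (strictMono_nat_of_lt_succ hlt).le_apply
  -- Locate `k` between two consecutive visits to states.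
  · have hex : ∃ i ≥ N, (y i).1.1 ≤ k ∧ k < (y (i + 1)).1.1 := by
      induction k, hk using Nat.le_induction with
      | base => exact ⟨N, le_rfl, le_rfl, hlt N⟩
      | succ k hk ih =>
        obtain ⟨i, h1, h2, h3⟩ := ih
        rcases Nat.lt_or_ge (k + 1) (y (i + 1)).1.1 with h4 | h4
        · exact ⟨i, h1, by omega, h4⟩
        · exact ⟨i + 1, by omega, h4, lt_of_le_of_lt h3 (hlt _)⟩
    obtain ⟨i, h1, h2, h3⟩ := hex
    rcases h2.eq_or_lt with h2 | h2
    · exact .inr ⟨i, h1, by rw [← h2]; exact hprio i⟩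
    · exact .inl (hn3 (y i) k h2 (by rwa [← hy]))

theorem mem_lang_iff [Finite Q] (hA : A.IsLinear) {t : InfTree Λ} {q : Q} :
    t ∈ A.lang q ↔ ∃ ρ, A.IsRun t q ρ :=
  ⟨exists_isRun hA, fun ⟨_, h⟩ => h.mem_lang⟩

theorem IsRun.sub_mem_lang [Finite Q] {t : InfTree Λ} {q : Q} {ρ : List Dir → Option Q}
    (h : A.IsRun t q ρ) {v : List Dir} {p : Q} (hv : ρ v = some p) :
    TreeAut.sub t v ∈ A.lang p := (h.sub hv).mem_lang

open Classical in
/-- A run may stop in the nodes whose subtrees are known to be accepted. -/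
theorem mem_lang_of_partial [Finite Q] (hA : A.IsLinear) {t : InfTree Λ} {q : Q}
    (ρ : List Dir → Option Q) (root : ρ [] = some q)
    (sat : ∀ v p, ρ v = some p → sub t v ∈ A.lang p ∨ (A.δ p (t v)).Sat
      (fun q' d => ρ (v ++ [d]) = some q' ∨ sub t (v ++ [d]) ∈ A.lang q'))
    (parity : ∀ (v : List Dir) (π : ℕ → Dir) (s : ℕ → Q), (∀ k, ρ (v ++ pre π k) = some (s k)) →
      EvenLiminf (fun k => A.priority (s k))) : t ∈ A.lang q := by
  -- Fix one accepting run for every accepted pair of a subtree and a state, to be pasted in where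
  -- `ρ` may stop.
  have hR : ∀ v p, ∃ R, sub t v ∈ A.lang p → A.IsRun (sub t v) p R := by
    intro v p
    by_cases h : sub t v ∈ A.lang p
    · obtain ⟨R, hR⟩ := exists_isRun hA h
      exact ⟨R, fun _ => hR⟩
    · exact ⟨fun _ => none, fun h' => (h h').elim⟩
  choose R hR using hR
  have hg : ∀ v p, ∃ g : Dir → Option Q, ρ v = some p → sub t v ∉ A.lang p →
      (∀ q' d, g d = some q' → ρ (v ++ [d]) = some q' ∨ sub t (v ++ [d]) ∈ A.lang q') ∧
      (A.δ p (t v)).Sat (fun q' d => g d = some q') := by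
    intro v p
    by_cases h : ρ v = some p ∧ sub t v ∉ A.lang p
    · obtain ⟨g, h1, h2⟩ := (hA p (t v)).exists_choice ((sat v p h.1).resolve_left h.2)
      exact ⟨g, fun _ _ => ⟨fun q' d e => (h1 q' d e).1, h2⟩⟩
    · exact ⟨fun _ => none, fun h1 h2 => (h ⟨h1, h2⟩).elim⟩
  choose g hg using hg
  -- the labels: a state of the given run, or the rest of a run on a subtree
  let ent : List Dir → Q → Q ⊕ (List Dir → Option Q) := fun v p =>
    if sub t v ∈ A.lang p then .inr (R v p) else .inl p
  let step : List Dir → Option (Q ⊕ (List Dir → Option Q)) → Dir →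
      Option (Q ⊕ (List Dir → Option Q)) := fun v x d => match x with
    | none => none
    | some (.inl p) => (g v p d).map (ent (v ++ [d]))
    | some (.inr f) => some (.inr fun w => f (d :: w))
  let L := unfold step (some (ent [] q))
  let lab : Option (Q ⊕ (List Dir → Option Q)) → Option Q := fun x => match x with
    | none => none
    | some (.inl p) => some p
    | some (.inr f) => f []
  have hL : ∀ v d, L (v ++ [d]) = step v (L v) d := fun v d => unfold_concat step _ v d
  have hlabent : ∀ v p, lab (some (ent v p)) = some p := by
    intro v p
    by_cases h : sub t v ∈ A.lang p
    · simp only [ent, if_pos h, lab]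
      exact (hR v p h).root
    · simp only [ent, if_neg h, lab]
  -- the invariant
  let Good : List Dir → Option (Q ⊕ (List Dir → Option Q)) → Prop := fun v x => match x with
    | none => True
    | some (.inl p) => ρ v = some p ∧ sub t v ∉ A.lang p
    | some (.inr f) => ∃ v₀ w p, v = v₀ ++ w ∧ A.IsRun (sub t v₀) p (R v₀ p) ∧
        f = fun u => R v₀ p (w ++ u)
  have hent : ∀ v p, ρ v = some p ∨ sub t v ∈ A.lang p → Good v (some (ent v p)) := by
    intro v p hv
    by_cases h : sub t v ∈ A.lang p
    · simp only [ent, if_pos h, Good]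
      exact ⟨v, [], p, by simp, hR v p h, rfl⟩
    · simp only [ent, if_neg h, Good]
      exact ⟨hv.resolve_right h, h⟩
  have hGood : ∀ v, Good v (L v) := by
    intro v
    induction v using List.reverseRecOn with
    | nil => exact hent [] q (.inl root)
    | append_singleton v d ih =>
      rw [hL]
      rcases hv : L v with _ | p | f
      · trivial
      · rw [hv] at ih
        rcases hgd : g v p d with _ | q'
        · simp [step, hgd, Good]
        · simp only [step, hgd, Option.map_some]
          exact hent _ _ ((hg v p ih.1 ih.2).1 q' d hgd)
      · rw [hv] at ih
        obtain ⟨v₀, w, p, rfl, h1, rfl⟩ := ih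
        exact ⟨v₀, w ++ [d], p, by simp, h1, by simp⟩
  refine IsRun.mem_lang (ρ := fun v => lab (L v)) ⟨hlabent [] q, fun v p hv => ?_, fun v π s hs => ?_⟩
  · have hG := hGood v
    rcases hLv : L v with _ | p' | f
    · simp [hLv, lab] at hv
    · rw [hLv] at hG hv
      obtain rfl : p' = p := by simpa [lab] using hv
      refine (hg v p' hG.1 hG.2).2.mono fun q' d hd => ?_
      simp only [hL, hLv, step, hd, Option.map_some, hlabent]
    · rw [hLv] at hG hv
      obtain ⟨v₀, w, r, rfl, h1, rfl⟩ := hG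
      have := h1.sat w p (by simpa [lab] using hv)
      refine Formula.Sat.mono (fun q' d hd => ?_) this
      simpa only [hL, hLv, step, lab] using hd
  -- A branch never leaves a pasted run, so it either has a tail in one of them or lies in `ρ`
  -- throughout.
  · by_cases hcut : ∃ k f, L (v ++ pre π k) = some (.inr f)
    · obtain ⟨N, f, hN⟩ := hcut
      have hG := hGood (v ++ pre π N)
      rw [hN] at hG
      obtain ⟨v₀, w, r, hv, h1, rfl⟩ := hG
      have hk : ∀ k, L (v ++ pre π (N + k)) =
          some (.inr fun u => R v₀ r (w ++ (pre (fun i => π (N + i)) k ++ u))) := by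
        intro k
        induction k with
        | zero => simpa using hN
        | succ k ih =>
          rw [← add_assoc, pre_succ, ← List.append_assoc, hL, ih]
          simp [step, pre_succ]
      rw [← evenLiminf_shift _ N]
      refine h1.parity w (fun i => π (N + i)) (fun k => s (N + k)) fun k => ?_
      have := hs (N + k)
      simpa [hk, lab] using this
    · push Not at hcut
      refine parity v π s fun k => ?_
      have hG := hGood (v ++ pre π k)
      have hk := hs k
      rcases hLv : L (v ++ pre π k) with _ | p' | f
      · simp [hLv, lab] at hk
      · rw [hLv] at hG
        simp only [hLv, lab, Option.some.injEq] at hk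
        exact hk ▸ hG.1
      · exact (hcut k f hLv).elim

end Automaton

/-! ### Formulas without `⊤` or `⊥` -/

namespace Formula

variable {Q P : Type}

theorem Sat.exists_atom {X : Q → Dir → Prop} {b : Formula Q} (h : b.Sat X) (hb : ¬b.UsesTop) :
    ∃ q d, X q d := by
  induction b with
  | top => exact (hb trivial).elim
  | bot => exact h.elim
  | atom q d => exact ⟨q, d, h⟩
  | or b c ihb ihc =>
    exact h.elim (fun h => ihb h fun h' => hb (.inl h')) (fun h => ihc h fun h' => hb (.inr h'))
  | and b c ihb ihc => exact ihb h.1 fun h' => hb (.inl h')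

theorem sat_true {b : Formula Q} (hb : ¬b.UsesBot) : b.Sat (fun _ _ => True) := by
  induction b with
  | top => trivial
  | bot => exact (hb trivial).elim
  | atom q d => trivial
  | or b c ihb ihc => exact .inl (ihb fun h => hb (.inl h))
  | and b c ihb ihc => exact ⟨ihb fun h => hb (.inl h), ihc fun h => hb (.inr h)⟩

end Formula

namespace Automaton

variable {Λ Q : Type} {A : Automaton Λ Q}

/-- Dependent choice, with the node carried along with its label. -/
theorem exists_branch {S : Type} {r : List Dir → S → Prop} {s₀ : S} (h₀ : r [] s₀)
    (hr : ∀ v s, r v s → ∃ d s', r (v ++ [d]) s') :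
    ∃ (π : ℕ → Dir) (s : ℕ → S), ∀ k, r (pre π k) (s k) := by
  have : Nonempty Dir := ⟨.L⟩
  choose! d s' h using hr
  let f : List Dir × S → List Dir × S := fun x => (x.1 ++ [d x.1 x.2], s' x.1 x.2)
  let y : ℕ → List Dir × S := fun k => f^[k] ([], s₀)
  have hy : ∀ k, y (k + 1) = f (y k) := fun k => Function.iterate_succ_apply' f k _
  let π : ℕ → Dir := fun k => d (y k).1 (y k).2
  have hpre : ∀ k, (y k).1 = pre π k := by
    intro k
    induction k with
    | zero => rfl
    | succ k ih => rw [hy, pre_succ, ← ih]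
  have hry : ∀ k, r (y k).1 (y k).2 := by
    intro k
    induction k with
    | zero => exact h₀
    | succ k ih => rw [hy]; exact h _ _ ih
  exact ⟨π, fun k => (y k).2, fun k => hpre k ▸ hry k⟩

/-! ### Automata with a single priority -/

theorem HasIndex.le {i j : ℕ} (h : A.HasIndex i j) : i ≤ j := by
  obtain ⟨e, o, -, -, h1, h2⟩ := h
  exact h1.2 h2.1

theorem HasIndex.bounds {i j : ℕ} (h : A.HasIndex i j) (q : Q) :
    i ≤ A.priority q ∧ A.priority q ≤ j := by
  obtain ⟨e, o, -, -, h1, h2⟩ := h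
  have : A.priority q ∈ A.usedPriorities e o := .inl (.inl ⟨q, rfl⟩)
  exact ⟨h1.2 this, h2.2 this⟩

/-- `⊥` would count as an odd priority, so it does not occur. Hence on every tree a run can be
continued from any node, and its branches have the constant even priority `i`. -/
theorem lang_eq_univ_of_hasIndex_self [Finite Q] (hA : A.IsLinear) {i : ℕ}
    (h : A.HasIndex i i) (hi : Even i) (q : Q) : A.lang q = Set.univ := by
  have hprio : ∀ q, A.priority q = i := fun q => le_antisymm (h.bounds q).2 (h.bounds q).1
  have hbot : ∀ q a, ¬(A.δ q a).UsesBot := by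
    intro q a hb
    obtain ⟨e, o, -, ho, h1, h2⟩ := h
    have : o ∈ A.usedPriorities e o := .inr ⟨rfl, q, a, hb⟩
    rw [le_antisymm (h2.2 this) (h1.2 this)] at ho
    exact Nat.not_even_iff_odd.2 ho hi
  refine Set.eq_univ_of_forall fun t => ?_
  have hg : ∀ v p, ∃ g : Dir → Option Q, (A.δ p (t v)).Sat (fun q' d => g d = some q') := by
    intro v p
    obtain ⟨g, -, hg⟩ := (hA p (t v)).exists_choice (Formula.sat_true (hbot p (t v)))
    exact ⟨g, hg⟩
  choose g hg using hg
  let ρ : List Dir → Option Q := unfold (fun v s d => s.bind fun p => g v p d) (some q)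
  refine IsRun.mem_lang (ρ := ρ) ⟨rfl, fun v p hv => ?_, fun v π s _ => ?_⟩
  · refine (hg v p).mono fun q' d hd => ?_
    simp only [ρ, unfold_concat] at hv ⊢
    rw [hv]
    exact hd
  · simp only [hprio]
    exact (evenLiminf_const i).2 hi

/-- `⊤` would count as an even priority, so it does not occur. Hence an accepting run would have an
infinite branch, of constant odd priority. -/
theorem lang_eq_empty_of_hasIndex_self [Finite Q] (hA : A.IsLinear) {i : ℕ}
    (h : A.HasIndex i i) (hi : Odd i) (q : Q) : A.lang q = ∅ := by
  have hprio : ∀ q, A.priority q = i := fun q => le_antisymm (h.bounds q).2 (h.bounds q).1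
  have htop : ∀ q a, ¬(A.δ q a).UsesTop := by
    intro q a hb
    obtain ⟨e, o, he, -, h1, h2⟩ := h
    have : e ∈ A.usedPriorities e o := .inl (.inr ⟨rfl, q, a, hb⟩)
    rw [le_antisymm (h2.2 this) (h1.2 this)] at he
    exact Nat.not_even_iff_odd.2 hi he
  refine Set.eq_empty_of_forall_notMem fun t ht => ?_
  obtain ⟨ρ, hρ⟩ := exists_isRun hA ht
  obtain ⟨π, s, hs⟩ := exists_branch (r := fun v p => ρ v = some p) hρ.root fun v p hv => by
    obtain ⟨q', d, h'⟩ := (hρ.sat v p hv).exists_atom (htop p (t v))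
    exact ⟨d, q', h'⟩
  have := hρ.parity [] π s hs
  simp only [hprio] at this
  exact Nat.not_even_iff_odd.2 hi ((evenLiminf_const i).1 this)

/-! ### Images and preimages under the projection of the alphabet -/

/-- The automaton reads the first component only. -/
def comapFst (B : Automaton Λ Q) (Γ : Type) : Automaton (Λ × Γ) Q where
  δ q a := B.δ q a.1
  priority := B.priority

theorem lang_comapFst [Finite Q] (hA : A.IsLinear) {Γ : Type} (q : Q) :
    (A.comapFst Γ).lang q = {u | (fun v => (u v).1) ∈ A.lang q} := by
  ext u
  rw [mem_lang_iff (A := A.comapFst Γ) (fun q a => hA q a.1), Set.mem_ofPred_eq, mem_lang_iff hA]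
  exact exists_congr fun ρ => ⟨fun h => ⟨h.root, h.sat, h.parity⟩, fun h => ⟨h.root, h.sat, h.parity⟩⟩

/-- The automaton guesses the second component, a letter of `{L, R, ⋆}`. -/
def mapFst (B : Automaton (Λ × Option Dir) Q) : Automaton Λ Q where
  δ q a := .or (.or (B.δ q (a, some .L)) (B.δ q (a, some .R))) (B.δ q (a, none))
  priority := B.priority

theorem exists_option_dir {p : Option Dir → Prop} :
    (∃ x, p x) ↔ (p (some .L) ∨ p (some .R)) ∨ p none := by
  constructor
  · rintro ⟨_ | _ | _, h⟩
    · exact .inr h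
    · exact .inl (.inl h)
    · exact .inl (.inr h)
  · rintro ((h | h) | h) <;> exact ⟨_, h⟩

theorem sat_mapFst {B : Automaton (Λ × Option Dir) Q} {X : Q → Dir → Prop} {q : Q} {a : Λ} :
    (B.mapFst.δ q a).Sat X ↔ ∃ x, (B.δ q (a, x)).Sat X :=
  (exists_option_dir (p := fun x => (B.δ q (a, x)).Sat X)).symm

theorem IsNondeterministic.mapFst {B : Automaton (Λ × Option Dir) Q} (h : B.IsNondeterministic) :
    B.mapFst.IsNondeterministic := fun q _ => .or (.or (h q _) (h q _)) (h q _)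

/-- A run has at most one state in each node, so the guesses made in different nodes combine to one
second component. -/
theorem lang_mapFst [Finite Q] {B : Automaton (Λ × Option Dir) Q} (h : B.IsNondeterministic)
    (q : Q) : B.mapFst.lang q = (fun u v => (u v).1) '' B.lang q := by
  ext t
  rw [mem_lang_iff h.mapFst.isLinear]
  constructor
  · rintro ⟨ρ, hρ⟩
    have hx : ∀ v, ∃ x, ∀ p, ρ v = some p →
        (B.δ p (t v, x)).Sat (fun q' d => ρ (v ++ [d]) = some q') := by
      intro v
      rcases hv : ρ v with _ | p
      · exact ⟨none, fun p hp => by simp at hp⟩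
      · obtain ⟨x, hx⟩ := sat_mapFst.1 (hρ.sat v p hv)
        exact ⟨x, fun p' hp => by rw [Option.some.injEq] at hp; exact hp ▸ hx⟩
    choose x hx using hx
    exact ⟨fun v => (t v, x v), IsRun.mem_lang ⟨hρ.root, fun v p hv => hx v p hv, hρ.parity⟩, rfl⟩
  · rintro ⟨u, hu, rfl⟩
    obtain ⟨ρ, hρ⟩ := exists_isRun h.isLinear hu
    exact ⟨ρ, hρ.root, fun v p hv => sat_mapFst.2 ⟨(u v).2, hρ.sat v p hv⟩, hρ.parity⟩

end Automaton

/-! ### The index under projection and its preimage -/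

theorem NondetRecognizable.image {Λ : Type} {M : Set (InfTree (Λ × Option Dir))} {i j : ℕ}
    (h : NondetRecognizable M i j) :
    NondetRecognizable ((fun (u : InfTree (Λ × Option Dir)) v => (u v).1) '' M) i j := by
  obtain ⟨Q, hQ, B, p, hB, hind, rfl⟩ := h
  refine ⟨Q, hQ, B.mapFst, p, hB.mapFst, ?_, Automaton.lang_mapFst hB p⟩
  have hused : ∀ e o, B.mapFst.usedPriorities e o = B.usedPriorities e o := by
    intro e o
    have h1 : (∃ q a, (B.mapFst.δ q a).UsesTop) ↔ ∃ q a, (B.δ q a).UsesTop := by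
      refine exists_congr fun q => ?_
      rw [Prod.exists]
      exact exists_congr fun a =>
        (Automaton.exists_option_dir (p := fun x => (B.δ q (a, x)).UsesTop)).symm
    have h2 : (∃ q a, (B.mapFst.δ q a).UsesBot) ↔ ∃ q a, (B.δ q a).UsesBot := by
      refine exists_congr fun q => ?_
      rw [Prod.exists]
      exact exists_congr fun a =>
        (Automaton.exists_option_dir (p := fun x => (B.δ q (a, x)).UsesBot)).symm
    rw [Automaton.usedPriorities, Automaton.usedPriorities, h1, h2]
    rfl
  simpa only [Automaton.HasIndex, hused] using hind

/-- With `Γ` empty there would be no letters, so `⊤` and `⊥` would no longer occur in transitions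
and the index could change. -/
theorem NondetRecognizable.preimage {Λ Γ : Type} [Nonempty Γ] {M : Set (InfTree Λ)} {i j : ℕ}
    (h : NondetRecognizable M i j) :
    NondetRecognizable {u : InfTree (Λ × Γ) | (fun v => (u v).1) ∈ M} i j := by
  obtain ⟨Q, hQ, B, p, hB, hind, rfl⟩ := h
  refine ⟨Q, hQ, B.comapFst Γ, p, fun q a => hB q a.1, ?_, Automaton.lang_comapFst hB.isLinear p⟩
  have hused : ∀ e o, (B.comapFst Γ).usedPriorities e o = B.usedPriorities e o := by
    intro e o
    have h1 : (∃ q a, ((B.comapFst Γ).δ q a).UsesTop) ↔ ∃ q a, (B.δ q a).UsesTop := by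
      simp [Automaton.comapFst]
    have h2 : (∃ q a, ((B.comapFst Γ).δ q a).UsesBot) ↔ ∃ q a, (B.δ q a).UsesBot := by
      simp [Automaton.comapFst]
    rw [Automaton.usedPriorities, Automaton.usedPriorities, h1, h2]
    rfl
  simpa only [Automaton.HasIndex, hused] using hind

/-! ### Deterministic transitions and transitions that check a move -/

namespace Formula

variable {Q : Type}

/-- The state that a deterministic transition sends in direction `d`. -/
def child : Formula Q → Dir → Option Q
  | atom q d', d => if d' = d then some q else none
  | and (atom q .L) (atom _ .R), .L => some q
  | and (atom _ .L) (atom q .R), .R => some q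
  | _, _ => none

/-- The state in direction `d` in a transition `(q_L, L) ∨ (q_R, R)`. -/
def option : Formula Q → Dir → Option Q
  | or (atom q .L) (atom _ .R), .L => some q
  | or (atom _ .L) (atom q .R), .R => some q
  | _, _ => none

theorem IsDeterministic.sat_iff {b : Formula Q} (h : b.IsDeterministic) {X : Q → Dir → Prop} :
    b.Sat X ↔ b ≠ bot ∧ ∀ d q, b.child d = some q → X q d := by
  rcases h with rfl | rfl | ⟨q, d, rfl⟩ | ⟨q, r, rfl⟩
  · simp [Sat, child]
  · simp [Sat]
  · simp [Sat, child]
  · refine ⟨fun h => ⟨by simp [andLR], ?_⟩, fun h => ⟨h.2 .L q rfl, h.2 .R r rfl⟩⟩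
    rintro (_ | _) q' hq
    · obtain rfl : q = q' := by simpa [andLR, child] using hq
      exact h.1
    · obtain rfl : r = q' := by simpa [andLR, child] using hq
      exact h.2

/-- The transition that checks that `x` describes the move of `∃` in a node with state `r` and
transition `b`; the states in `U` are known to accept all trees. -/
def strat (U : Q → Bool) (r : Q) (x : Option Dir) (b : Formula Q) : Formula Q :=
  if U r then top else
    match b, x with
    | top, none => top
    | atom q d, none => atom q d
    | or (atom q .L) (atom q' .R), x =>
      if U q || U q' then top else
        match x with
        | some .L => atom q .L
        | some .R => atom q' .R
        | none => bot
    | and (atom q .L) (atom q' .R), none => andLR q q'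
    | _, _ => bot

theorem strat_isDeterministic (U : Q → Bool) (r : Q) (x : Option Dir) {b : Formula Q}
    (hb : b.IsGame) : (b.strat U r x).IsDeterministic := by
  unfold strat
  split_ifs
  · exact .inl rfl
  rcases hb with rfl | rfl | ⟨q, d, rfl⟩ | ⟨q, q', rfl⟩ | ⟨q, q', rfl⟩
  · rcases x with _ | _
    · exact .inl rfl
    · exact .inr (.inl rfl)
  · exact .inr (.inl rfl)
  · rcases x with _ | _
    · exact .inr (.inr (.inl ⟨q, d, rfl⟩))
    · exact .inr (.inl rfl)
  · simp only [orLR]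
    split_ifs
    · exact .inl rfl
    rcases x with _ | _ | _
    · exact .inr (.inl rfl)
    · exact .inr (.inr (.inl ⟨_, _, rfl⟩))
    · exact .inr (.inr (.inl ⟨_, _, rfl⟩))
  · rcases x with _ | _
    · exact .inr (.inr (.inr ⟨q, q', rfl⟩))
    · exact .inr (.inl rfl)

/-- If a disjunction was replaced by `⊤`, its option in `U` satisfies it by `hU`. For `r` in `U` the
check would say nothing about `b`. -/
theorem sat_of_strat {U : Q → Bool} {r : Q} {x : Option Dir} {b : Formula Q} (hb : b.IsGame)
    {X : Q → Dir → Prop} (hr : U r = false) (hU : ∀ q d, U q = true → X q d)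
    (hx : (b.strat U r x).Sat X) : b.Sat X := by
  unfold strat at hx
  rw [hr, if_neg (by simp)] at hx
  rcases hb with rfl | rfl | ⟨q, d, rfl⟩ | ⟨q, q', rfl⟩ | ⟨q, q', rfl⟩
  · trivial
  · exact hx
  · rcases x with _ | _
    · exact hx
    · exact hx.elim
  · simp only [orLR] at hx
    split_ifs at hx with h
    · rw [Bool.or_eq_true] at h
      exact h.imp (hU q _) (hU q' _)
    · rcases x with _ | _ | _
      · exact hx.elim
      · exact .inl hx
      · exact .inr hx
  · rcases x with _ | _
    · exact hx
    · exact hx.elim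

/-- The hypothesis `hU` says that an option of `∃` dropped by the check is useless unless it lies in
`U`; hence `b` must be satisfied by the option that `x` names. -/
theorem strat_sat_of {U : Q → Bool} {r : Q} {x : Option Dir} {b : Formula Q} (hb : b.IsGame)
    {X : Q → Dir → Prop} (hx : b.strat U r x ≠ bot)
    (hU : ∀ q d, (b.strat U r x).child d = none → b.option d = some q → X q d → U q = true)
    (h : b.Sat X) : (b.strat U r x).Sat X := by
  unfold strat at hx hU ⊢
  split_ifs at hx hU ⊢ with hr
  · trivial
  rcases hb with rfl | rfl | ⟨q, d, rfl⟩ | ⟨q, q', rfl⟩ | ⟨q, q', rfl⟩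
  · rcases x with _ | _
    · trivial
    · exact (hx rfl).elim
  · exact (hx rfl).elim
  · rcases x with _ | _
    · exact h
    · exact (hx rfl).elim
  · simp only [orLR] at hx hU ⊢
    split_ifs at hx hU ⊢ with h'
    · trivial
    rw [Bool.or_eq_true, not_or] at h'
    rcases x with _ | _ | _
    · exact (hx rfl).elim
    · exact h.resolve_right fun h => h'.2 (hU q' .R rfl rfl h)
    · exact h.resolve_left fun h => h'.1 (hU q .L rfl rfl h)
  · rcases x with _ | _
    · exact h
    · exact (hx rfl).elim

theorem exists_strat_sat {U : Q → Bool} (r : Q) {b : Formula Q} (hb : b.IsGame)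
    {X : Q → Dir → Prop} (h : b.Sat X) : ∃ x, (b.strat U r x).Sat X := by
  by_cases hr : U r = true
  · exact ⟨none, by rw [show b.strat U r none = top from if_pos hr]; trivial⟩
  simp only [strat, if_neg hr]
  rcases hb with rfl | rfl | ⟨q, d, rfl⟩ | ⟨q, q', rfl⟩ | ⟨q, q', rfl⟩
  · exact ⟨none, trivial⟩
  · exact h.elim
  · exact ⟨none, h⟩
  · simp only [orLR]
    split_ifs
    · exact ⟨none, trivial⟩
    · rcases h with h | h
      · exact ⟨some .L, h⟩
      · exact ⟨some .R, h⟩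
  · exact ⟨none, h⟩

end Formula

namespace Automaton

variable {Λ Q : Type}

/-! ### Deterministic automata -/

/-- The run of a deterministic automaton, `none` in the nodes that are not visited. -/
def mode {Γ : Type} (D : Automaton Γ Q) : Q → InfTree Γ → List Dir → Option Q
  | r, _, [] => some r
  | r, u, d :: w => ((D.δ r (u [])).child d).bind fun r' => D.mode r' (sub u [d]) w

theorem mode_concat {Γ : Type} (D : Automaton Γ Q) (r : Q) (u : InfTree Γ) (v : List Dir)
    (d : Dir) :
    D.mode r u (v ++ [d]) = (D.mode r u v).bind fun r' => (D.δ r' (u v)).child d := by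
  induction v generalizing r u with
  | nil =>
    simp only [List.nil_append, mode, Option.bind_some]
    exact Option.bind_fun_some _
  | cons c v ih =>
    simp only [List.cons_append, mode, Option.bind_assoc]
    congr 1
    funext r'
    rw [ih]
    rfl

/-- Every accepting run extends `mode`, since each transition forces its children; conversely `mode`
is itself a run when no `⊥` is met. -/
theorem IsDeterministic.mem_lang_iff_mode [Finite Q] {Γ : Type} {D : Automaton Γ Q}
    (hD : D.IsDeterministic) {u : InfTree Γ} {q : Q} :
    u ∈ D.lang q ↔ (∀ v p, D.mode q u v = some p → D.δ p (u v) ≠ .bot) ∧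
      ∀ (v : List Dir) (π : ℕ → Dir) (s : ℕ → Q), (∀ k, D.mode q u (v ++ pre π k) = some (s k)) →
        EvenLiminf (fun k => D.priority (s k)) := by
  constructor
  · intro hu
    obtain ⟨ρ, hρ⟩ := exists_isRun hD.isLinear hu
    have hmode : ∀ v p, D.mode q u v = some p → ρ v = some p := by
      intro v
      induction v using List.reverseRecOn with
      | nil => intro p hp; rw [hρ.root]; exact hp
      | append_singleton v d ih =>
        intro p hp
        rw [mode_concat, Option.bind_eq_some_iff] at hp
        obtain ⟨p', h1, h2⟩ := hp
        exact ((hD _ _).sat_iff.1 (hρ.sat v p' (ih p' h1))).2 d p h2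
    exact ⟨fun v p hp => ((hD _ _).sat_iff.1 (hρ.sat v p (hmode v p hp))).1,
      fun v π s hs => hρ.parity v π s fun k => hmode _ _ (hs k)⟩
  · rintro ⟨h1, h2⟩
    refine IsRun.mem_lang (ρ := D.mode q u) ⟨rfl, fun v p hp => ?_, h2⟩
    refine (hD _ _).sat_iff.2 ⟨h1 v p hp, fun d q' hq => ?_⟩
    rw [mode_concat, hp]
    exact hq

/-! ### The automaton that checks strategies -/

/-- The deterministic automaton that checks that the second component of a tree encodes a winning
strategy of `∃` on its first component; the states in `U` are known to accept all trees. -/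
def strat (A : Automaton Λ Q) (U : Q → Bool) : Automaton (Λ × Option Dir) Q where
  δ q a := (A.δ q a.1).strat U q a.2
  priority := A.priority

variable {A : Automaton Λ Q} {U : Q → Bool}

theorem IsGame.strat (hA : A.IsGame) (U : Q → Bool) : (A.strat U).IsDeterministic :=
  fun q a => Formula.strat_isDeterministic U q a.2 (hA q a.1)

theorem strat_δ_of_univ {r : Q} (hr : U r = true) (a : Λ × Option Dir) :
    (A.strat U).δ r a = .top := if_pos hr

/-- The run of the checking automaton is a partial run of `A` that stops at states in `U`. It reads
`t` only in the nodes covered by `ht`, so the same argument serves the first component of `u` and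
the cut tree. -/
theorem mem_lang_of_strat [Finite Q] (hA : A.IsGame) (hU : ∀ r, U r = true → A.lang r = Set.univ)
    {u : InfTree (Λ × Option Dir)} {q : Q} (hu : u ∈ (A.strat U).lang q) {t : InfTree Λ}
    (ht : ∀ v r, (A.strat U).mode q u v = some r → U r = false → t v = (u v).1) :
    t ∈ A.lang q := by
  obtain ⟨h1, h2⟩ := (hA.strat U).mem_lang_iff_mode.1 hu
  refine mem_lang_of_partial hA.isLinear ((A.strat U).mode q u) rfl (fun v p hp => ?_) h2
  rcases hUp : U p
  · right
    rw [ht v p hp hUp]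
    refine Formula.sat_of_strat (x := (u v).2) (hA _ _) hUp
      (fun q' d hq => .inr (by rw [hU q' hq]; trivial)) ?_
    refine ((hA.strat U) p (u v)).sat_iff.2 ⟨h1 v p hp, fun d q' hq => .inl ?_⟩
    rw [mode_concat, hp]
    exact hq
  · left
    rw [hU p hUp]
    trivial

/-- Read off from an accepting run of `A` which option it takes in each node; that run then
satisfies the checking transitions as well. -/
theorem lang_eq_image_strat [Finite Q] (hA : A.IsGame)
    (hU : ∀ r, U r = true → A.lang r = Set.univ) (q : Q) :
    A.lang q = (fun u v => (u v).1) '' (A.strat U).lang q := by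
  ext t
  constructor
  · intro ht
    obtain ⟨ρ, hρ⟩ := exists_isRun hA.isLinear ht
    have hx : ∀ v, ∃ x, ∀ p, ρ v = some p →
        ((A.strat U).δ p (t v, x)).Sat (fun q' d => ρ (v ++ [d]) = some q') := by
      intro v
      rcases hv : ρ v with _ | p
      · exact ⟨none, fun p hp => by simp at hp⟩
      · obtain ⟨x, hx⟩ := Formula.exists_strat_sat (U := U) p (hA _ _) (hρ.sat v p hv)
        exact ⟨x, fun p' hp => by rw [Option.some.injEq] at hp; exact hp ▸ hx⟩
    choose x hx using hx
    exact ⟨fun v => (t v, x v), IsRun.mem_lang ⟨hρ.root, fun v p hv => hx v p hv, hρ.parity⟩, rfl⟩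
  · rintro ⟨u, hu, rfl⟩
    exact mem_lang_of_strat hA hU hu fun _ _ _ _ => rfl

/-! ### Forcing `∃` to follow an encoded strategy -/

open Classical in
/-- The first component of `u`, where `∃` is forced to follow the second component: the subtrees
that she must not enter in state `r` are replaced with `τ r`. -/
noncomputable def cut (A : Automaton Λ Q) (U : Q → Bool) (τ : Q → InfTree Λ) :
    Q → InfTree (Λ × Option Dir) → List Dir → Λ
  | r, u, [] => if (A.strat U).δ r (u []) = .bot then τ r [] else (u []).1
  | r, u, d :: w =>
    if (A.strat U).δ r (u []) = .bot then τ r (d :: w) else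
      match ((A.strat U).δ r (u [])).child d with
      | some r' => cut A U τ r' (sub u [d]) w
      -- The default `r` is used only when the transition of `A` is not a disjunction; then either
      -- this child is not visited by `A` or `r` is in `U`, so the choice of subtree is immaterial.
      | none => τ (((A.δ r (u []).1).option d).getD r) w

variable {τ : Q → InfTree Λ} {r : Q} {u : InfTree (Λ × Option Dir)}

theorem cut_of_bot (h : (A.strat U).δ r (u []) = .bot) : A.cut U τ r u = τ r := by
  funext w
  cases w <;> rw [cut, if_pos h]

theorem cut_nil (h : (A.strat U).δ r (u []) ≠ .bot) : A.cut U τ r u [] = (u []).1 := by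
  rw [cut, if_neg h]

theorem sub_cut_some {d : Dir} {r' : Q} (hc : ((A.strat U).δ r (u [])).child d = some r') :
    sub (A.cut U τ r u) [d] = A.cut U τ r' (sub u [d]) := by
  have h : (A.strat U).δ r (u []) ≠ .bot := by
    intro h
    rw [h] at hc
    simp [Formula.child] at hc
  funext w
  rw [sub, List.singleton_append, cut, if_neg h, hc]

theorem sub_cut_none {d : Dir} (h : (A.strat U).δ r (u []) ≠ .bot)
    (hc : ((A.strat U).δ r (u [])).child d = none) :
    sub (A.cut U τ r u) [d] = τ (((A.δ r (u []).1).option d).getD r) := by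
  funext w
  rw [sub, List.singleton_append, cut, if_neg h, hc]

theorem sub_cut_mode {v : List Dir} {p : Q} (h : (A.strat U).mode r u v = some p) :
    sub (A.cut U τ r u) v = A.cut U τ p (sub u v) := by
  induction v using List.reverseRecOn generalizing p with
  | nil =>
    obtain rfl : r = p := by simpa [mode] using h
    rfl
  | append_singleton v d ih =>
    rw [mode_concat, Option.bind_eq_some_iff] at h
    obtain ⟨p', h1, h2⟩ := h
    rw [← sub_sub, ih h1, sub_cut_some (r' := p) (by simpa using h2), sub_sub]

/-- A run of `A` on the cut tree cannot enter a subtree `τ r` in a state `r` outside `U`. So it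
takes the options named by `u` and never meets a rejection of the checking automaton, whose run is
thus part of it. -/
theorem cut_mem_lang_iff [Finite Q] (hA : A.IsGame) (hU : ∀ r, U r = true ↔ A.lang r = Set.univ)
    (hτ : ∀ r, U r = false → τ r ∉ A.lang r) {q : Q} {u : InfTree (Λ × Option Dir)} :
    A.cut U τ q u ∈ A.lang q ↔ u ∈ (A.strat U).lang q := by
  constructor
  · intro h
    obtain ⟨ρ, hρ⟩ := exists_isRun hA.isLinear h
    have hne : ∀ v p, (A.strat U).mode q u v = some p → ρ v = some p →
        (A.strat U).δ p (u v) ≠ .bot := by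
      intro v p h1 h2 hbot
      have h3 := hρ.sub_mem_lang h2
      rw [sub_cut_mode h1, cut_of_bot (by simpa using hbot)] at h3
      rcases hUp : U p
      · exact hτ p hUp h3
      · rw [strat_δ_of_univ hUp] at hbot
        cases hbot
    have hsat : ∀ v p, (A.strat U).mode q u v = some p → ρ v = some p →
        ((A.strat U).δ p (u v)).Sat (fun q' d => ρ (v ++ [d]) = some q') := by
      intro v p h1 h2
      have h3 := hne v p h1 h2
      have h4 := hρ.sat v p h2
      have h5 : A.cut U τ q u v = (u v).1 := by
        rw [← sub_apply_nil (A.cut U τ q u) v, sub_cut_mode h1, cut_nil (by simpa using h3)]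
        simp
      rw [h5] at h4
      refine Formula.strat_sat_of (hA _ _) h3 (fun q' d h6 h7 h8 => ?_) h4
      have h9 := hρ.sub_mem_lang h8
      rw [← sub_sub, sub_cut_mode h1, sub_cut_none (by simpa using h3)
        (by rw [sub_apply_nil]; exact h6)] at h9
      simp only [sub_apply_nil, h7, Option.getD_some] at h9
      rcases hUq : U q'
      · exact (hτ q' hUq h9).elim
      · rfl
    have hmode : ∀ v p, (A.strat U).mode q u v = some p → ρ v = some p := by
      intro v
      induction v using List.reverseRecOn with
      | nil => intro p hp; rw [hρ.root]; exact hp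
      | append_singleton v d ih =>
        intro p hp
        rw [mode_concat, Option.bind_eq_some_iff] at hp
        obtain ⟨p', h1, h2⟩ := hp
        exact (((hA.strat U) _ _).sat_iff.1 (hsat v p' h1 (ih p' h1))).2 d p h2
    exact (hA.strat U).mem_lang_iff_mode.2 ⟨fun v p hp => hne v p hp (hmode v p hp),
      fun v π s hs => hρ.parity v π s fun k => hmode _ _ (hs k)⟩
  · intro h
    refine mem_lang_of_strat hA (fun r => (hU r).1) h fun v p hp _ => ?_
    have h1 := ((hA.strat U).mem_lang_iff_mode.1 h).1 v p hp
    rw [← sub_apply_nil (A.cut U τ q u) v, sub_cut_mode hp, cut_nil (by simpa using h1)]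
    simp

end Automaton

namespace Automaton

variable {Λ Q P : Type}

/-! ### Simulation on the modified trees -/

/-- If `i < j`, an even or an odd number between `i` and `j`. -/
def sinkPriority {i j : ℕ} (hij : i < j) (b : Prop) [Decidable b] : Set.Icc i j :=
  if (b ↔ Even i) then ⟨i, le_rfl, hij.le⟩ else ⟨i + 1, Nat.le_succ i, hij⟩

theorem even_sinkPriority {i j : ℕ} (hij : i < j) (b : Prop) [Decidable b] :
    Even (sinkPriority hij b : ℕ) ↔ b := by
  unfold sinkPriority
  split_ifs with h
  · exact h.symm
  · simp only [Nat.even_add_one]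
    tauto

open Classical in
/-- The automaton that simulates `B` on `A.cut U τ r u` while it reads `u`. -/
noncomputable def simulate (A : Automaton Λ Q) (U : Q → Bool) (τ : Q → InfTree Λ)
    (B : Automaton Λ P) {i j : ℕ} (hij : i < j) :
    Automaton (Λ × Option Dir) (P × Q ⊕ Set.Icc i j) where
  δ
    | .inl (p, r), a =>
      if (A.strat U).δ r a = .bot then .atom (.inr (sinkPriority hij (τ r ∈ B.lang p))) .L
      else (B.δ p a.1).map fun p' d =>
        match ((A.strat U).δ r a).child d with
        | some r' => .inl (p', r')
        | none => .inr (sinkPriority hij (τ (((A.δ r a.1).option d).getD r) ∈ B.lang p'))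
    | .inr s, _ => .atom (.inr s) .L
  priority
    | .inl (p, _) => B.priority p
    | .inr s => s

variable {A : Automaton Λ Q} {U : Q → Bool} {τ : Q → InfTree Λ} {B : Automaton Λ P} {i j : ℕ}
  {hij : i < j}

open Classical in
theorem simulate_δ_bot {p : P} {r : Q} {a : Λ × Option Dir} (h : (A.strat U).δ r a = .bot) :
    (simulate A U τ B hij).δ (.inl (p, r)) a =
      .atom (.inr (sinkPriority hij (τ r ∈ B.lang p))) .L := if_pos h

open Classical in
theorem simulate_δ_ne {p : P} {r : Q} {a : Λ × Option Dir} (h : (A.strat U).δ r a ≠ .bot) :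
    (simulate A U τ B hij).δ (.inl (p, r)) a = (B.δ p a.1).map fun p' d =>
      match ((A.strat U).δ r a).child d with
      | some r' => .inl (p', r')
      | none => .inr (sinkPriority hij (τ (((A.δ r a.1).option d).getD r) ∈ B.lang p')) :=
  if_neg h

theorem IsNondeterministic.simulate (hB : B.IsNondeterministic) :
    (simulate A U τ B hij).IsNondeterministic := by
  rintro (⟨p, r⟩ | s) a
  · simp only [Automaton.simulate]
    split_ifs
    · exact .det (.inr (.inr (.inl ⟨_, _, rfl⟩)))
    · exact (hB p a.1).map
  · exact .det (.inr (.inr (.inl ⟨_, _, rfl⟩)))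

/-- There is a sink for every number from `i` to `j`, and `⊤` and `⊥` can be given priorities in
this interval, so the used priorities are exactly the interval. -/
theorem hasIndex_simulate (hB : B.HasIndex i j) : (simulate A U τ B hij).HasIndex i j := by
  classical
  have hmem : ∀ e o, e ∈ Set.Icc i j → o ∈ Set.Icc i j →
      (simulate A U τ B hij).usedPriorities e o ⊆ Set.Icc i j := by
    rintro e o he ho p ((⟨⟨q, r⟩ | s, rfl⟩ | ⟨rfl, -⟩) | ⟨rfl, -⟩)
    · exact hB.bounds q
    · exact s.2
    · exact he
    · exact ho
  have hsub : ∀ e o, Set.Icc i j ⊆ (simulate A U τ B hij).usedPriorities e o :=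
    fun e o p hp => .inl (.inl ⟨.inr ⟨p, hp⟩, rfl⟩)
  refine ⟨sinkPriority hij True, sinkPriority hij False, (even_sinkPriority hij True).2 trivial,
    Nat.not_even_iff_odd.1 ((even_sinkPriority hij False).1), ?_, ?_⟩
  · exact ⟨hsub _ _ ⟨le_rfl, hij.le⟩, fun p hp => (hmem _ _ (Subtype.coe_prop _)
      (Subtype.coe_prop _) hp).1⟩
  · exact ⟨hsub _ _ ⟨hij.le, le_rfl⟩, fun p hp => (hmem _ _ (Subtype.coe_prop _)
      (Subtype.coe_prop _) hp).2⟩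

theorem IsRun.even_sink {u : InfTree (Λ × Option Dir)} {x : P × Q ⊕ Set.Icc i j}
    {ρ : List Dir → Option (P × Q ⊕ Set.Icc i j)} (hρ : (simulate A U τ B hij).IsRun u x ρ)
    {v : List Dir} {s : Set.Icc i j} (hv : ρ v = some (.inr s)) : Even (s : ℕ) := by
  refine (evenLiminf_const _).1 (hρ.parity v (fun _ => .L) (fun _ => .inr s) fun k => ?_)
  induction k with
  | zero => simpa using hv
  | succ k ih =>
    rw [pre_succ, ← List.append_assoc]
    exact hρ.sat _ _ ih

theorem lang_sink [Finite P] [Finite Q] {s : Set.Icc i j} (hs : Even (s : ℕ)) :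
    (simulate A U τ B hij).lang (.inr s) = Set.univ := by
  refine Set.eq_univ_of_forall fun u => ?_
  refine IsRun.mem_lang (ρ := fun _ => some (.inr s)) ⟨rfl, fun v p hp => ?_, fun v π f hf => ?_⟩
  · rw [Option.some.injEq] at hp
    subst hp
    exact rfl
  · have : ∀ k, f k = .inr s := fun k => (Option.some.inj (hf k)).symm
    simp only [this]
    exact (evenLiminf_const _).2 hs

/-- Along `mode` the subtrees of the cut tree are again cut trees (`sub_cut_mode`), so runs of the
two automata correspond there. Outside, a subtree is some `τ r`, and an even sink stands for its
acceptance by `B`. Both directions thus use partial runs that end where a fixed tree begins. -/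
theorem mem_lang_simulate_iff [Finite P] [Finite Q] (hB : B.IsNondeterministic) {p : P} {r : Q}
    {u : InfTree (Λ × Option Dir)} :
    u ∈ (simulate A U τ B hij).lang (.inl (p, r)) ↔ A.cut U τ r u ∈ B.lang p := by
  classical
  have hsimL : (simulate A U τ B hij).IsLinear := hB.simulate.isLinear
  constructor
  · intro h
    obtain ⟨ρ, hρ⟩ := exists_isRun hsimL h
    -- Comparing the second component with `mode` builds the invariant into the definition.
    let ρ' : List Dir → Option P := fun v => match ρ v with
      | some (.inl (p', r')) => if (A.strat U).mode r u v = some r' then some p' else none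
      | _ => none
    have hρ' : ∀ v p', ρ' v = some p' ↔
        ∃ r', ρ v = some (.inl (p', r')) ∧ (A.strat U).mode r u v = some r' := by
      intro v p'
      simp only [ρ']
      rcases ρ v with _ | ⟨p₁, r₁⟩ | s
      · simp
      · by_cases hm : (A.strat U).mode r u v = some r₁ <;> simp [hm]
      · simp
    refine mem_lang_of_partial hB.isLinear ρ' ((hρ' [] p).2 ⟨r, hρ.root, rfl⟩)
      (fun v p' hp => ?_) (fun v π s hs => ?_)
    · obtain ⟨r', h1, h2⟩ := (hρ' v p').1 hp
      have h3 := hρ.sat v _ h1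
      by_cases hbot : (A.strat U).δ r' (u v) = .bot
      · left
        rw [sub_cut_mode h2, cut_of_bot (by simpa using hbot)]
        rw [simulate_δ_bot hbot] at h3
        exact (even_sinkPriority hij _).1 (hρ.even_sink h3)
      · right
        have h5 : A.cut U τ r u v = (u v).1 := by
          rw [← sub_apply_nil (A.cut U τ r u) v, sub_cut_mode h2, cut_nil (by simpa using hbot)]
          simp
        rw [simulate_δ_ne hbot, Formula.sat_map] at h3
        rw [h5]
        refine h3.mono fun q' d hd => ?_
        rcases hc : ((A.strat U).δ r' (u v)).child d with _ | r''
        · right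
          rw [← sub_sub, sub_cut_mode h2, sub_cut_none (by simpa using hbot)
            (by rw [sub_apply_nil]; exact hc), sub_apply_nil]
          rw [hc] at hd
          exact (even_sinkPriority hij _).1 (hρ.even_sink hd)
        · left
          rw [hc] at hd
          exact (hρ' _ _).2 ⟨r'', hd, by rw [mode_concat, h2]; exact hc⟩
    · choose r' h1 _ using fun k => (hρ' _ _).1 (hs k)
      exact hρ.parity v π (fun k => .inl (s k, r' k)) h1
  · intro h
    obtain ⟨ρ, hρ⟩ := exists_isRun hB.isLinear h
    let ρ' : List Dir → Option (P × Q ⊕ Set.Icc i j) := fun v =>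
      (ρ v).bind fun p' => ((A.strat U).mode r u v).map fun r' => .inl (p', r')
    have hρ' : ∀ v x, ρ' v = some x ↔
        ∃ p' r', ρ v = some p' ∧ (A.strat U).mode r u v = some r' ∧ .inl (p', r') = x := by
      intro v x
      simp [ρ', Option.bind_eq_some_iff]
    refine mem_lang_of_partial hsimL ρ' ((hρ' [] _).2 ⟨p, r, hρ.root, rfl, rfl⟩)
      (fun v x hx => ?_) (fun v π s hs => ?_)
    · obtain ⟨p', r', h1, h2, rfl⟩ := (hρ' v x).1 hx
      right
      have h3 := hρ.sat v _ h1
      by_cases hbot : (A.strat U).δ r' (u v) = .bot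
      · rw [simulate_δ_bot hbot]
        right
        rw [lang_sink]
        · trivial
        · rw [even_sinkPriority]
          have := hρ.sub_mem_lang h1
          rwa [sub_cut_mode h2, cut_of_bot (by simpa using hbot)] at this
      · have h5 : A.cut U τ r u v = (u v).1 := by
          rw [← sub_apply_nil (A.cut U τ r u) v, sub_cut_mode h2, cut_nil (by simpa using hbot)]
          simp
        rw [simulate_δ_ne hbot, Formula.sat_map]
        rw [h5] at h3
        refine h3.mono fun q' d hd => ?_
        rcases hc : ((A.strat U).δ r' (u v)).child d with _ | r''
        · right
          dsimp only
          rw [lang_sink]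
          · trivial
          · rw [even_sinkPriority]
            have := hρ.sub_mem_lang hd
            rwa [← sub_sub, sub_cut_mode h2, sub_cut_none (by simpa using hbot)
              (by rw [sub_apply_nil]; exact hc), sub_apply_nil] at this
        · left
          exact (hρ' _ _).2 ⟨q', r'', hd, by rw [mode_concat, h2]; exact hc, rfl⟩
    · choose p' r' h1 _ h3 using fun k => (hρ' _ _).1 (hs k)
      have := hρ.parity v π p' h1
      convert this using 2 with k
      rw [← h3]
      rfl

/-- The simulation needs sinks of both parities, hence `i < j`. The case `i = j` occurs only for the
empty and the full language, where the language of the checking automaton is the preimage under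
projection. -/
theorem nondetRecognizable_iff_strat [Finite Q] (hA : A.IsGame)
    (hU : ∀ r, U r = true ↔ A.lang r = Set.univ) (q : Q) (i j : ℕ) :
    NondetRecognizable (A.lang q) i j ↔ NondetRecognizable ((A.strat U).lang q) i j := by
  have himage := lang_eq_image_strat hA (fun r => (hU r).1) q
  constructor
  · intro h
    by_cases htriv : (A.strat U).lang q = {u | (fun v => (u v).1) ∈ A.lang q}
    · rw [htriv]
      exact h.preimage
    have hne : A.lang q ≠ ∅ := by
      intro h0
      refine htriv ?_
      rw [h0] at himage ⊢
      simpa using himage.symm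
    have hnu : A.lang q ≠ Set.univ := by
      intro h1
      refine htriv ?_
      rw [h1]
      refine Set.eq_univ_of_forall fun u => ?_
      -- The state `q` is in `U`, so the run consists of the root alone.
      refine ((hA.strat U).mem_lang_iff_mode).2 ⟨fun v p hp => ?_, fun v π s hs => ?_⟩
      · rcases v with _ | ⟨d, v⟩
        · obtain rfl : q = p := by simpa [mode] using hp
          rw [strat_δ_of_univ ((hU q).2 h1)]
          simp
        · simp [mode, strat_δ_of_univ ((hU q).2 h1), Formula.child] at hp
      · have h2 := hs (v.length + 1)
        rcases hw : v ++ pre π (v.length + 1) with _ | ⟨d, w⟩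
        · simp [pre_succ] at hw
        · rw [hw] at h2
          simp [mode, strat_δ_of_univ ((hU q).2 h1), Formula.child] at h2
    obtain ⟨P, hP, B, p, hB, hind, hlang⟩ := h
    have hij : i < j := by
      refine lt_of_le_of_ne hind.le ?_
      rintro rfl
      rcases Nat.even_or_odd i with hi | hi
      · exact hnu (hlang ▸ lang_eq_univ_of_hasIndex_self hB.isLinear hind hi p)
      · exact hne (hlang ▸ lang_eq_empty_of_hasIndex_self hB.isLinear hind hi p)
    have hτ : ∀ r, ∃ t : InfTree Λ, U r = false → t ∉ A.lang r := by
      intro r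
      by_cases hr : U r = false
      · obtain ⟨t, ht⟩ := (Set.ne_univ_iff_exists_notMem _).1
          (fun h => by simp [(hU r).2 h] at hr : A.lang r ≠ Set.univ)
        exact ⟨t, fun _ => ht⟩
      · obtain ⟨t, -⟩ := Set.nonempty_iff_ne_empty.2 hne
        exact ⟨t, fun h => (hr h).elim⟩
    choose τ hτ using hτ
    refine ⟨_, inferInstance, simulate A U τ B hij, .inl (p, q), hB.simulate,
      hasIndex_simulate hind, ?_⟩
    ext u
    rw [mem_lang_simulate_iff hB, hlang, cut_mem_lang_iff hA hU hτ]
  · intro h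
    rw [himage]
    exact h.image

end Automaton

namespace Automaton

variable {Λ Q : Type} {A : Automaton Λ Q} {U : Q → Bool}

/-! ### Strategies in the run game -/

theorem strat_δ_eq_bot_iff (hA : A.IsGame) (hU : ∀ r, U r = false) {r : Q} {a : Λ}
    {x : Option Dir} : (A.strat U).δ r (a, x) = .bot ↔
      A.δ r a = .bot ∨ ((∃ q₁ q₂, A.δ r a = .orLR q₁ q₂) ∧ x = none) ∨
        ((¬∃ q₁ q₂, A.δ r a = .orLR q₁ q₂) ∧ x ≠ none) := by
  rcases hA r a with h | h | ⟨q, d, h⟩ | ⟨q, q', h⟩ | ⟨q, q', h⟩ <;>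
    rcases x with _ | _ | _ <;>
    simp [strat, Formula.strat, h, hU, Formula.orLR, Formula.andLR]

theorem nextLabel_of_child_strat (hA : A.IsGame) (hU : ∀ r, U r = false) {r r' : Q} {a : Λ}
    {x : Option Dir} {d : Dir} (hc : ((A.strat U).δ r (a, x)).child d = some r') :
    A.nextLabel (.state r) a d = .state r' ∧
      ((∃ q₁ q₂, A.δ r a = .orLR q₁ q₂) → x = some d) := by
  rcases hA r a with h | h | ⟨q, d', h⟩ | ⟨q, q', h⟩ | ⟨q, q', h⟩ <;>
    rcases x with _ | _ | _ <;> rcases d with _ | _ <;>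
    simp_all [strat, Formula.strat, Formula.orLR, Formula.andLR, Formula.child, nextLabel]

/-- The second alternative reflects that the deterministic run ends at a transition `⊤`, while the
run game moves on to a child labelled `⊤`. -/
theorem child_strat_of_nextLabel (hA : A.IsGame) (hU : ∀ r, U r = false) {r : Q} {a : Λ}
    {x : Option Dir} {d : Dir} (hbot : (A.strat U).δ r (a, x) ≠ .bot)
    (hn : A.nextLabel (.state r) a d ≠ .star)
    (hx : (∃ q₁ q₂, A.δ r a = .orLR q₁ q₂) → x = some d) :
    (∃ r', ((A.strat U).δ r (a, x)).child d = some r') ∨ A.nextLabel (.state r) a d = .top := by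
  rcases hA r a with h | h | ⟨q, d', h⟩ | ⟨q, q', h⟩ | ⟨q, q', h⟩ <;>
    rcases x with _ | _ | _ <;> rcases d with _ | _ <;>
    simp_all [strat, Formula.strat, Formula.orLR, Formula.andLR, Formula.child, nextLabel]

theorem exists_nextLabel_ne_star (hA : A.IsGame) (r : Q) (a : Λ) :
    ∃ d, A.nextLabel (.state r) a d ≠ .star := by
  rcases hA r a with h | h | ⟨q, d', h⟩ | ⟨q, q', h⟩ | ⟨q, q', h⟩
  · exact ⟨.L, by simp [nextLabel, h]⟩
  · exact ⟨.L, by simp [nextLabel, h]⟩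
  · exact ⟨d', by simp [nextLabel, h]⟩
  · exact ⟨.L, by simp [nextLabel, h, Formula.orLR]⟩
  · exact ⟨.L, by simp [nextLabel, h, Formula.andLR]⟩

theorem nextLabel_ne_star_of_or {r q₁ q₂ : Q} {a : Λ} (h : A.δ r a = .orLR q₁ q₂) (d : Dir) :
    A.nextLabel (.state r) a d ≠ .star := by
  cases d <;> simp [nextLabel, h, Formula.orLR]

theorem run_of_mode (hA : A.IsGame) (hU : ∀ r, U r = false) {q r : Q}
    {u : InfTree (Λ × Option Dir)} {v : List Dir} (h : (A.strat U).mode q u v = some r) :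
    A.run (fun v => (u v).1) q v = .state r := by
  induction v using List.reverseRecOn generalizing r with
  | nil =>
    obtain rfl : q = r := by simpa [mode] using h
    rfl
  | append_singleton v d ih =>
    rw [mode_concat, Option.bind_eq_some_iff] at h
    obtain ⟨p, h1, h2⟩ := h
    rw [run_concat, ih h1]
    exact (nextLabel_of_child_strat hA hU h2).1

theorem mem_existsPos_runGame_iff {t : InfTree Λ} {q r : Q} {v : List Dir}
    (h : A.run t q v = .state r) :
    v ∈ (A.runGame t q).existsPos ↔ ∃ q₁ q₂, A.δ r (t v) = .orLR q₁ q₂ := by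
  constructor
  · rintro ⟨r', q₁, q₂, h1, h2⟩
    rw [h] at h1
    injection h1 with h1
    exact ⟨q₁, q₂, h1 ▸ h2⟩
  · rintro ⟨q₁, q₂, h2⟩
    exact ⟨r, q₁, q₂, h, h2⟩

open Classical in
/-- The strategy encoded by `s`. -/
noncomputable def decodeStrategy (A : Automaton Λ Q) (t : InfTree Λ) (q : Q)
    (s : InfTree (Option Dir)) (v : List Dir) : List Dir :=
  -- The default direction keeps the strategy legal at positions of `∃` where `s` gives no
  -- direction.
  if v ∈ (A.runGame t q).existsPos then v ++ [(s v).getD .L] else v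

/-- A play conforming to the decoded strategy either follows a branch of the deterministic run,
whose parity condition it inherits, or ends in a loop at `⊤`. As the run never meets `⊥`, the
letters of `s` are of the right kind in its nodes. -/
theorem mem_winningStrategies_of_mem_lang [Finite Q] (hA : A.IsGame) (hU : ∀ r, U r = false)
    {q : Q} {u : InfTree (Λ × Option Dir)} (hu : u ∈ (A.strat U).lang q) :
    u ∈ A.winningStrategies q := by
  obtain ⟨hbot, hpar⟩ := (hA.strat U).mem_lang_iff_mode.1 hu
  let t : InfTree Λ := fun v => (u v).1
  let s : InfTree (Option Dir) := fun v => (u v).2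
  let σ := A.decodeStrategy t q s
  have hσ : ∀ {v}, v ∈ (A.runGame t q).existsPos → σ v = v ++ [(s v).getD .L] := fun h => if_pos h
  have hstrat : (A.runGame t q).IsStrategy σ := by
    intro v hv
    rw [hσ hv]
    obtain ⟨r, q₁, q₂, h1, h2⟩ := hv
    refine .inl ⟨by simp [h1], ?_, _, rfl⟩
    rw [run_concat, h1]
    exact nextLabel_ne_star_of_or h2 _
  have hs : ∀ {v r}, (A.strat U).mode q u v = some r → v ∈ (A.runGame t q).existsPos →
      ∃ d, s v = some d := by
    intro v r hm hv
    have := hbot v r hm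
    rw [← Option.ne_none_iff_exists']
    intro h0
    exact this ((strat_δ_eq_bot_iff hA hU).2 (.inr (.inl
      ⟨(mem_existsPos_runGame_iff (run_of_mode hA hU hm)).1 hv, h0⟩)))
  -- a play conforming to the strategy stays in the nodes visited by the deterministic run, or it
  -- reaches a node labelled `⊤`
  have hplay : ∀ π, (A.runGame t q).IsPlay π → (A.runGame t q).Conforms σ π → ∀ k,
      (∃ r, (A.strat U).mode q u (π k) = some r) ∨ A.run t q (π k) = .top := by
    intro π hπ hc k
    induction k with
    | zero => left; rw [hπ.1]; exact ⟨q, rfl⟩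
    | succ k ih =>
      rcases ih with ⟨r, hm⟩ | htop
      · have hrun : A.run t q (π k) = .state r := run_of_mode hA hU hm
        rcases hπ.2 k with ⟨-, h2, d, hd⟩ | ⟨h, -⟩
        · rw [hd] at h2 ⊢
          rw [run_concat, hrun] at h2 ⊢
          rcases child_strat_of_nextLabel hA hU (hbot _ _ hm) h2 (fun hor => by
              have hmem := (mem_existsPos_runGame_iff hrun).2 hor
              obtain ⟨d', hd'⟩ := hs hm hmem
              have := hc k hmem
              rw [hσ hmem, hd, hd'] at this
              have hdd : d = d' := by simpa using this
              exact hdd ▸ hd') with ⟨r', h⟩ | h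
          · exact .inl ⟨r', by rw [mode_concat, hm]; exact h⟩
          · exact .inr h
        · rcases h with h | h <;> rw [hrun] at h <;> cases h
      · rcases hπ.2 k with ⟨-, h2, d, hd⟩ | ⟨-, h⟩
        · rw [hd, run_concat, htop] at h2
          exact (h2 rfl).elim
        · rw [h]; exact .inr htop
  refine ⟨σ, ⟨hstrat, fun π hπ hc => ?_⟩, fun v r hv hrun => ?_⟩
  · change EvenLiminf fun k => A.labelPriority (A.run t q (π k))
    by_cases htop : ∃ k, A.run t q (π k) = .top
    · obtain ⟨N, hN⟩ := htop
      have hj : ∀ j, A.run t q (π (N + j)) = .top := by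
        intro j
        induction j with
        | zero => exact hN
        | succ j ih =>
          rcases hπ.2 (N + j) with ⟨-, h2, d, hd⟩ | ⟨-, h⟩
          · rw [hd, run_concat, ih] at h2
            exact (h2 rfl).elim
          · rw [← add_assoc, h]; exact ih
      rw [← evenLiminf_shift _ N]
      simp only [hj]
      exact (evenLiminf_const 0).2 (by decide)
    · push Not at htop
      choose r hr using fun k => (hplay π hπ hc k).resolve_right (htop k)
      have hrun : ∀ k, A.run t q (π k) = .state (r k) := fun k => run_of_mode hA hU (hr k)
      have hd : ∀ k, ∃ d, π (k + 1) = π k ++ [d] := by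
        intro k
        rcases hπ.2 k with ⟨-, -, h⟩ | ⟨h, -⟩
        · exact h
        · rcases h with h | h <;> rw [hrun] at h <;> cases h
      choose d hd using hd
      have hpre : ∀ k, π k = pre d k := by
        intro k
        induction k with
        | zero => exact hπ.1
        | succ k ih => rw [hd, ih, pre_succ]
      have := hpar [] d r fun k => by rw [List.nil_append, ← hpre]; exact hr k
      simp only [hrun]
      exact this
  · obtain ⟨π, hπ, hc, k, rfl⟩ := hv
    rcases hplay π hπ hc k with ⟨r', hm⟩ | h
    · constructor
      · intro hv
        obtain ⟨d, hd⟩ := hs hm hv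
        refine ⟨d, hd, ?_⟩
        rw [hσ hv, hd]
        rfl
      · intro hv
        by_contra h0
        exact hbot _ _ hm ((strat_δ_eq_bot_iff hA hU).2 (.inr (.inr
          ⟨fun h => hv ((mem_existsPos_runGame_iff (run_of_mode hA hU hm)).2 h), h0⟩)))
    · change A.run t q (π k) = .state r at hrun
      rw [h] at hrun
      cases hrun

/-- Visits are defined through infinite plays, so a finite prefix must be extended. This is possible
because no node labelled other than `∗` is a dead end. -/
theorem visits_of_reach (hA : A.IsGame) {t : InfTree Λ} {q : Q} {σ : List Dir → List Dir}
    (hσ : (A.runGame t q).IsStrategy σ) {v : List Dir} (hv : (A.runGame t q).Reach σ v) :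
    (A.runGame t q).Visits σ v := by
  classical
  have hne : A.run t q v ≠ .star := by
    induction hv with
    | start => exact fun h => by cases h
    | step _ he _ ih =>
      rcases he with ⟨-, h, -⟩ | ⟨-, h⟩
      · exact h
      · rw [h]; exact ih
  have hnext : ∀ x : {x // A.run t q x ≠ .star}, ∃ y : {x // A.run t q x ≠ .star},
      (A.runGame t q).edge x y ∧ (x.1 ∈ (A.runGame t q).existsPos → y.1 = σ x) := by
    rintro ⟨x, hx⟩
    by_cases hmem : x ∈ (A.runGame t q).existsPos
    · have he := hσ x hmem
      refine ⟨⟨σ x, ?_⟩, he, fun _ => rfl⟩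
      rcases he with ⟨-, h, -⟩ | ⟨-, h⟩
      · exact h
      · rw [h]; exact hx
    · by_cases hloop : A.run t q x = .top ∨ A.run t q x = .bot
      · exact ⟨⟨x, hx⟩, .inr ⟨hloop, rfl⟩, fun h => (hmem h).elim⟩
      · rcases hrun : A.run t q x with r | _ | _ | _
        · obtain ⟨d, hd⟩ := exists_nextLabel_ne_star hA r (t x)
          have hd' : A.run t q (x ++ [d]) ≠ .star := by rwa [run_concat, hrun]
          exact ⟨⟨x ++ [d], hd'⟩, .inl ⟨hx, hd', d, rfl⟩, fun h => (hmem h).elim⟩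
        · exact (hloop (.inl hrun)).elim
        · exact (hloop (.inr hrun)).elim
        · exact (hx hrun).elim
  choose nxt h1 h2 using hnext
  let y : ℕ → {x // A.run t q x ≠ .star} := fun k => nxt^[k] ⟨v, hne⟩
  have hy : ∀ k, y (k + 1) = nxt (y k) := fun k => Function.iterate_succ_apply' nxt k _
  obtain ⟨π, N, h3, h4, h5⟩ := hv.exists_play (c := fun k => (y k).1) rfl
    (fun k => by rw [hy]; exact h1 _) (fun k hk => by dsimp only; rw [hy]; exact h2 _ hk)
  exact ⟨π, h3, h4, N, h5 0⟩

/-- Since `s` encodes `σ`, every node of the deterministic run is reached by `σ`, and the branches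
of the run are tails of conforming plays. A transition `⊥` would mean that `s` has a wrong letter or
that `A` itself rejects. -/
theorem mem_lang_of_mem_winningStrategies [Finite Q] (hA : A.IsGame) (hU : ∀ r, U r = false)
    {q : Q} {u : InfTree (Λ × Option Dir)} (hu : u ∈ A.winningStrategies q) :
    u ∈ (A.strat U).lang q := by
  obtain ⟨σ, hw, henc⟩ := hu
  let t : InfTree Λ := fun v => (u v).1
  change (A.runGame t q).IsWinning σ at hw
  change A.Encodes t q (fun v => (u v).2) σ at henc
  have hconf : ∀ {v d r r'}, (A.strat U).mode q u v = some r → (A.runGame t q).Reach σ v →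
      ((A.strat U).δ r (u v)).child d = some r' → v ∈ (A.runGame t q).existsPos →
      v ++ [d] = σ v := by
    intro v d r r' hm hr hc hv
    have hrun := run_of_mode hA hU hm
    obtain ⟨d', h1, h2⟩ := (henc v r (visits_of_reach hA hw.1 hr) hrun).1 hv
    have h3 := (nextLabel_of_child_strat hA hU hc).2 ((mem_existsPos_runGame_iff hrun).1 hv)
    dsimp only at h1
    rw [h3, Option.some.injEq] at h1
    rw [h2, h1]
  have hedge : ∀ {v d r r'}, (A.strat U).mode q u v = some r →
      (A.strat U).mode q u (v ++ [d]) = some r' → (A.runGame t q).edge v (v ++ [d]) := by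
    intro v d r r' h1 h2
    have h1' : A.run t q v = .state r := run_of_mode hA hU h1
    have h2' : A.run t q (v ++ [d]) = .state r' := run_of_mode hA hU h2
    exact .inl ⟨by simp [h1'], by simp [h2'], d, rfl⟩
  have hchild : ∀ {v d r r'}, (A.strat U).mode q u v = some r →
      (A.strat U).mode q u (v ++ [d]) = some r' → ((A.strat U).δ r (u v)).child d = some r' := by
    intro v d r r' h1 h2
    rwa [mode_concat, h1] at h2
  have hreach : ∀ v r, (A.strat U).mode q u v = some r → (A.runGame t q).Reach σ v := by
    intro v
    induction v using List.reverseRecOn with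
    | nil => exact fun _ _ => .start
    | append_singleton v d ih =>
      intro r hr
      have h := hr
      rw [mode_concat, Option.bind_eq_some_iff] at h
      obtain ⟨p, h1, h2⟩ := h
      exact (ih p h1).step (hedge h1 hr) fun hv => hconf h1 (ih p h1) h2 hv
  refine (hA.strat U).mem_lang_iff_mode.2 ⟨fun v r hm hbot => ?_, fun v π s hs => ?_⟩
  · have hrun : A.run t q v = .state r := run_of_mode hA hU hm
    have hr := hreach v r hm
    have he := henc v r (visits_of_reach hA hw.1 hr) hrun
    rw [mem_existsPos_runGame_iff hrun] at he
    rcases (strat_δ_eq_bot_iff hA hU).1 hbot with h | ⟨h1, h2⟩ | ⟨h1, h2⟩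
    -- If `A` rejects at `v`, moving to a child labelled `⊥` and looping there gives a conforming
    -- play of priority `1`.
    · have hlab : A.run t q (v ++ [.L]) = .bot := by
        rw [run_concat, hrun]
        change A.nextLabel (.state r) (u v).1 .L = .bot
        simp [nextLabel, h]
      have hnot : v ∉ (A.runGame t q).existsPos := by
        rw [mem_existsPos_runGame_iff hrun]
        rintro ⟨q₁, q₂, h'⟩
        change A.δ r (u v).1 = _ at h'
        rw [h] at h'
        cases h'
      have hnot' : v ++ [.L] ∉ (A.runGame t q).existsPos := by
        rintro ⟨r', _, _, h', -⟩
        rw [hlab] at h'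
        cases h'
      have hr' : (A.runGame t q).Reach σ (v ++ [.L]) :=
        hr.step (.inl ⟨by simp [hrun], by simp [hlab], .L, rfl⟩) fun h => (hnot h).elim
      have := hw.evenLiminf hr' (c := fun _ => v ++ [.L]) rfl (fun _ => .inr ⟨.inr hlab, rfl⟩)
        (fun _ h => (hnot' h).elim)
      change EvenLiminf (fun _ => A.labelPriority (A.run t q (v ++ [.L]))) at this
      rw [hlab] at this
      exact absurd ((evenLiminf_const 1).1 this) (by decide)
    · obtain ⟨d, hd, -⟩ := he.1 h1
      simp [h2] at hd
    · exact h2 (he.2 h1)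
  · have hs' : ∀ k, (A.strat U).mode q u ((v ++ pre π k) ++ [π k]) = some (s (k + 1)) := by
      intro k
      rw [List.append_assoc, ← pre_succ]
      exact hs (k + 1)
    have := hw.evenLiminf (hreach v (s 0) (by simpa using hs 0)) (c := fun k => v ++ pre π k)
      (by simp) (fun k => by
        rw [pre_succ, ← List.append_assoc]
        exact hedge (hs k) (hs' k))
      (fun k hk => by
        dsimp only
        rw [pre_succ, ← List.append_assoc]
        exact hconf (hs k) (hreach _ _ (hs k)) (hchild (hs k) (hs' k)) hk)
    change EvenLiminf (fun k => A.labelPriority (A.run t q (v ++ pre π k))) at this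
    have hrun : ∀ k, A.run t q (v ++ pre π k) = .state (s k) := fun k => run_of_mode hA hU (hs k)
    simp only [hrun] at this
    exact this

theorem lang_strat_eq_winningStrategies [Finite Q] (hA : A.IsGame) (hU : ∀ r, U r = false)
    (q : Q) : (A.strat U).lang q = A.winningStrategies q :=
  Set.Subset.antisymm (fun _ => mem_winningStrategies_of_mem_lang hA hU)
    fun _ => mem_lang_of_mem_winningStrategies hA hU

end Automaton

/-! ## Stacks of states without repetitions -/

section Stack

variable {S : Type} [DecidableEq S]

/-- The least priority in the part of the stack from the top to the first occurrence of `q`. -/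
def segMin (pr : S → ℕ) (q : S) : List S → ℕ
  | [] => 0
  | x :: xs => if x = q then pr x else min (pr x) (segMin pr q xs)

/-- Put `q` on the stack, or return to `q` if it is already there. -/
def push (q : S) (h : List S) : List S := if q ∈ h then h.dropWhile (· ≠ q) else q :: h

theorem exists_append_of_mem_nodup {q : S} {h : List S} (hq : q ∈ h) (hn : h.Nodup) :
    ∃ w w', h = w ++ q :: w' ∧ q ∉ w ∧ push q h = q :: w' := by
  obtain ⟨w, w', rfl⟩ := List.append_of_mem hq
  have hw : q ∉ w := fun hw => (List.nodup_append.1 hn).2.2 q hw q (by simp) rfl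
  refine ⟨w, w', rfl, hw, ?_⟩
  rw [push, if_pos hq, List.dropWhile_append_of_pos, List.dropWhile_cons_of_neg (by simp)]
  intro x hx
  simpa using fun e : x = q => hw (e ▸ hx)

theorem push_suffix {q : S} {h : List S} (hq : q ∈ h) : push q h <:+ h := by
  rw [push, if_pos hq]
  exact List.dropWhile_suffix _

theorem nodup_push {q : S} {h : List S} (hn : h.Nodup) : (push q h).Nodup := by
  by_cases hq : q ∈ h
  · exact hn.sublist (push_suffix hq).sublist
  · rw [push, if_neg hq]
    exact hn.cons hq

theorem head?_push {q : S} {h : List S} (hn : h.Nodup) : (push q h).head? = some q := by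
  by_cases hq : q ∈ h
  · obtain ⟨w, w', -, -, e⟩ := exists_append_of_mem_nodup hq hn
    rw [e]; rfl
  · rw [push, if_neg hq]; rfl

theorem segMin_le {pr : S → ℕ} {q x : S} {w w' : List S} (hw : q ∉ w) (hx : x ∈ w ∨ x = q) :
    segMin pr q (w ++ q :: w') ≤ pr x := by
  induction w with
  | nil =>
    obtain rfl := hx.resolve_left (by simp)
    simp [segMin]
  | cons y w ih =>
    rw [List.mem_cons, not_or] at hw
    rw [List.cons_append, segMin, if_neg (Ne.symm hw.1)]
    rcases hx with hx | hx
    · rcases List.mem_cons.1 hx with rfl | hx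
      · exact min_le_left _ _
      · exact (min_le_right _ _).trans (ih hw.2 (.inl hx))
    · exact (min_le_right _ _).trans (ih hw.2 (.inr hx))

theorem le_segMin {pr : S → ℕ} {q : S} {w w' : List S} {p : ℕ} (hw : ∀ x ∈ w, p ≤ pr x)
    (hq : p ≤ pr q) : p ≤ segMin pr q (w ++ q :: w') := by
  induction w with
  | nil => simpa [segMin] using hq
  | cons y w ih =>
    rw [List.cons_append, segMin]
    split_ifs
    · exact hw y (by simp)
    · exact le_min (hw y (by simp)) (ih fun x hx => hw x (by simp [hx]))

theorem segMin_succ {pr : S → ℕ} {q : S} {h : List S} (hq : q ∈ h) :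
    segMin (fun x => pr x + 1) q h = segMin pr q h + 1 := by
  induction h with
  | nil => simp at hq
  | cons x h ih =>
    simp only [segMin]
    split_ifs with hx
    · rfl
    · rw [ih ((List.mem_cons.1 hq).resolve_left (Ne.symm hx)), Nat.add_min_add_right]

theorem segMin_map {T : Type} [DecidableEq T] {f : S → T} (hf : Function.Injective f)
    {pr : S → ℕ} {pr' : T → ℕ} (hpr : ∀ x, pr' (f x) = pr x) (q : S) (h : List S) :
    segMin pr' (f q) (h.map f) = segMin pr q h := by
  induction h with
  | nil => rfl
  | cons x h ih => simp only [List.map_cons, segMin, hf.eq_iff, hpr, ih]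

/-- A quantity that decreases when a state of priority `p` is visited, as long as no cycle is
closed whose least priority is odd and no lower priority is visited. -/
def potential (pr : S → ℕ) (p n : ℕ) (h : List S) : ℕ :=
  (h.dropWhile fun x => p ≤ pr x).length * (n + 1) + (n - h.countP fun x => pr x = p)

/-- Pushing a new state keeps the first summand, and a state of priority `p` raises the count.
Returning to `q` pops a segment `w`. If `w` stays at or above `p`, the even minimum of the cycle
shows that neither `w` nor `q` has priority `p`, and nothing changes. Otherwise a priority below `p`
is popped; the first summand then drops by at least `n + 1`, which outweighs any change of the
count. -/
theorem potential_push [Fintype S] {pr : S → ℕ} {p : ℕ} (hp : Odd p) {q : S} (hq : p ≤ pr q)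
    {h : List S} (hn : h.Nodup) (he : q ∈ h → Even (segMin pr q h)) :
    potential pr p (Fintype.card S) (push q h) ≤ potential pr p (Fintype.card S) h ∧
      (pr q = p →
        potential pr p (Fintype.card S) (push q h) < potential pr p (Fintype.card S) h) := by
  have hcount : ∀ h : List S, h.Nodup → (h.countP fun x => pr x = p) ≤ Fintype.card S :=
    fun h hn => List.countP_le_length.trans hn.length_le_card
  by_cases hmem : q ∈ h
  · obtain ⟨w, w', rfl, hw, e⟩ := exists_append_of_mem_nodup hmem hn
    rw [e]
    by_cases hall : ∀ x ∈ w, p ≤ pr x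
    · have hne : ∀ x, x ∈ w ∨ x = q → pr x ≠ p := by
        intro x hx hxp
        have h1 := segMin_le (pr := pr) (w' := w') hw hx
        have h2 := le_segMin (w' := w') hall hq
        have h3 := he hmem
        rw [hxp] at h1
        rw [le_antisymm h1 h2] at h3
        exact Nat.not_even_iff_odd.2 hp h3
      have h1 : (w ++ q :: w').dropWhile (fun x => decide (p ≤ pr x)) =
          (q :: w').dropWhile (fun x => decide (p ≤ pr x)) :=
        List.dropWhile_append_of_pos fun x hx => by simpa using hall x hx
      have h2 : w.countP (fun x => decide (pr x = p)) = 0 :=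
        List.countP_eq_zero.2 fun x hx => by simpa using hne x (.inl hx)
      simp only [potential, h1, List.countP_append, h2, zero_add]
      exact ⟨le_rfl, fun h => (hne q (.inr rfl) h).elim⟩
    · have hlt : potential pr p (Fintype.card S) (q :: w') <
          potential pr p (Fintype.card S) (w ++ q :: w') := by
        have h1 : ((q :: w').dropWhile (fun x => decide (p ≤ pr x))).length <
            ((w ++ q :: w').dropWhile (fun x => decide (p ≤ pr x))).length := by
          have h2 : (w.dropWhile (fun x => decide (p ≤ pr x))).isEmpty = false := by
            rw [List.isEmpty_eq_false_iff, Ne, List.dropWhile_eq_nil_iff]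
            simpa using hall
          rw [List.dropWhile_append, h2, List.dropWhile_cons_of_pos (by simpa using hq)]
          have h3 := (List.dropWhile_suffix (l := w') (fun x => decide (p ≤ pr x))).length_le
          simp only [Bool.false_eq_true, if_false, List.length_append, List.length_cons]
          omega
        simp only [potential]
        have h4 := Nat.mul_le_mul_right (Fintype.card S + 1) h1
        rw [Nat.succ_mul] at h4
        omega
      exact ⟨hlt.le, fun _ => hlt⟩
  · have hc := hcount _ (hn.cons hmem)
    rw [push, if_neg hmem]
    simp only [potential]
    rw [List.dropWhile_cons_of_pos (by simpa using hq)]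
    rw [List.countP_cons] at hc ⊢
    split_ifs at hc ⊢ with hqp
    · exact ⟨by omega, fun _ => by omega⟩
    · exact ⟨by omega, fun h => (hqp (by simpa using h)).elim⟩

/-- If all cycles that are closed have an even least priority, then the parity condition holds. -/
theorem evenLiminf_of_stack [Fintype S] {pr : S → ℕ} {h : ℕ → List S} {s : ℕ → S}
    (hn : (h 0).Nodup) (hs : ∀ k, h (k + 1) = push (s (k + 1)) (h k))
    (he : ∀ k, s (k + 1) ∈ h k → Even (segMin pr (s (k + 1)) (h k))) :
    EvenLiminf fun k => pr (s k) := by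
  have hnk : ∀ k, (h k).Nodup := by
    intro k
    induction k with
    | zero => exact hn
    | succ k ih => rw [hs]; exact nodup_push ih
  refine (evenLiminf_iff (M := ⨆ x, pr x)
    (fun k => le_ciSup (Set.finite_range pr).bddAbove (s k))).2 fun p hp hfreq => ?_
  by_contra! hlow
  have hev : ∀ᶠ k in atTop, ∀ p' ∈ Set.Iio p, pr (s k) ≠ p' := by
    rw [Filter.eventually_all_finite (Set.finite_Iio p)]
    intro p' hp'
    simpa [Filter.Frequently] using hlow p' hp'
  obtain ⟨N, hN⟩ := Filter.eventually_atTop.1 hev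
  have hge : ∀ k ≥ N, p ≤ pr (s k) := fun k hk => by
    by_contra hlt
    exact hN k hk _ (not_le.1 hlt) rfl
  let Φ := fun k => potential pr p (Fintype.card S) (h k)
  have hstep : ∀ k ≥ N, Φ (k + 1) ≤ Φ k ∧ (pr (s (k + 1)) = p → Φ (k + 1) < Φ k) := by
    intro k hk
    simp only [Φ, hs]
    exact potential_push hp (hge (k + 1) (by omega)) (hnk k) (he k)
  have hanti : ∀ k ≥ N, ∀ j, Φ (k + j) ≤ Φ k := by
    intro k hk j
    induction j with
    | zero => exact le_rfl
    | succ j ih => exact (hstep (k + j) (by omega)).1.trans ih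
  -- From `N` on, the potential never grows, and it drops at each of the infinitely many visits to
  -- priority `p`: an infinite descent.
  have hcontra : ∀ m, ∀ k ≥ N, Φ k ≠ m := by
    intro m
    induction m using Nat.strong_induction_on with
    | _ m ih =>
      rintro k hk rfl
      obtain ⟨k', hk', e⟩ := Filter.frequently_atTop.1 hfreq (k + 1)
      obtain ⟨j, rfl⟩ := Nat.exists_eq_add_of_le hk'
      rw [Nat.add_right_comm] at e
      exact ih _ (((hstep (k + j) (by omega)).2 e).trans_le (hanti k hk j)) (k + j + 1)
        (by omega) rfl
  exact hcontra _ N le_rfl rfl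

end Stack

/-! ## Dual automata -/

namespace Formula

variable {Q : Type}

/-- The dual formula. -/
def dual : Formula Q → Formula Q
  | top => bot
  | bot => top
  | atom q d => atom q d
  | or b c => and (dual b) (dual c)
  | and b c => or (dual b) (dual c)

theorem sat_dual {X : Q → Dir → Prop} {b : Formula Q} :
    b.dual.Sat (fun q d => ¬X q d) ↔ ¬b.Sat X := by
  induction b with
  | top => simp [dual, Sat]
  | bot => simp [dual, Sat]
  | atom => rfl
  | or b c ihb ihc => simp only [dual, Sat, ihb, ihc, not_or]
  | and b c ihb ihc => simp only [dual, Sat, ihb, ihc, not_and_or]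

theorem IsGame.dual {b : Formula Q} (h : b.IsGame) : b.dual.IsGame := by
  rcases h with rfl | rfl | ⟨q, d, rfl⟩ | ⟨q, r, rfl⟩ | ⟨q, r, rfl⟩
  · exact .inr (.inl rfl)
  · exact .inl rfl
  · exact .inr (.inr (.inl ⟨q, d, rfl⟩))
  · exact .inr (.inr (.inr (.inr ⟨q, r, rfl⟩)))
  · exact .inr (.inr (.inr (.inl ⟨q, r, rfl⟩)))

end Formula

namespace Automaton

variable {Λ Q : Type} {A : Automaton Λ Q}

/-- The dual automaton. -/
def dual (A : Automaton Λ Q) : Automaton Λ Q where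
  δ q a := (A.δ q a).dual
  priority q := A.priority q + 1

theorem IsGame.dual (h : A.IsGame) : A.dual.IsGame := fun q a => (h q a).dual

/-- Accepting runs of both automata would share an infinite branch, on which the priorities differ
by one throughout. -/
theorem notMem_lang_of_mem_dual [Finite Q] (hA : A.IsGame) {t : InfTree Λ} {q : Q}
    (h : t ∈ A.dual.lang q) : t ∉ A.lang q := by
  intro h'
  obtain ⟨ρ, hρ⟩ := exists_isRun hA.dual.isLinear h
  obtain ⟨ρ', hρ'⟩ := exists_isRun hA.isLinear h'
  obtain ⟨π, s, hs⟩ := exists_branch (r := fun v p => ρ v = some p ∧ ρ' v = some p)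
    ⟨hρ.root, hρ'.root⟩ fun v p hv => by
      by_contra! hno
      refine Formula.sat_dual.1 ((hρ.sat v p hv.1).mono fun q' d hq => ?_) (hρ'.sat v p hv.2)
      exact fun hq' => hno d q' hq hq'
  obtain ⟨e, he, h1, h2⟩ := hρ.parity [] π s fun k => (hs k).1
  obtain ⟨e', he', h1', h2'⟩ := hρ'.parity [] π s fun k => (hs k).2
  have h3 : e ≤ e' + 1 := h2 (h1'.mono fun k (hk : A.priority (s k) = e') => by
    rw [← hk]; rfl)
  have hpos : 1 ≤ e := by
    obtain ⟨k, hk⟩ := Filter.Frequently.exists h1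
    exact hk ▸ Nat.le_add_left 1 _
  have h4 : e' ≤ e - 1 := h2' (h1.mono fun k (hk : A.priority (s k) + 1 = e) => by
    dsimp only; omega)
  obtain rfl : e = e' + 1 := by omega
  exact (Nat.even_add_one.1 he) he'

/-! ### Universality -/

/-- From the stack `h`, moving to the state `q` closes a cycle whose least priority is even, or
leads to a stack in `W`. -/
def GoodMove [DecidableEq Q] (pr : Q → ℕ) (W : List Q → Prop) (h : List Q) (q : Q) : Prop :=
  if q ∈ h then Even (segMin pr q h) else W (q :: h)

/-- The run carries stacks, with the current state on top, and `∃` chooses good moves. Closing a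
cycle returns to a suffix of the stack, so the invariant asks that all nonempty suffixes lie in `W`.
Each node carries at most one stack, which is why the letters of the tree may depend on it. -/
theorem exists_mem_lang_of_stack [Fintype Q] [DecidableEq Q] (hA : A.IsLinear) {W : List Q → Prop}
    (letter : List Dir → List Q → Λ) {q : Q} (hq : W [q])
    (hW : ∀ v r h, (r :: h).Nodup → W (r :: h) →
      (A.δ r (letter v (r :: h))).Sat fun q' _ => GoodMove A.priority W (r :: h) q') :
    ∃ t ∈ A.lang q, ∃ st : List Dir → List Q, ∀ v, t v = letter v (st v) := by
  let Inv : List Q → Prop := fun h => h.Nodup ∧ h ≠ [] ∧ ∀ h', h' <:+ h → h' ≠ [] → W h'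
  have hg : ∀ v h, ∃ g : Dir → Option Q, Inv h → ∃ r, h.head? = some r ∧
      (∀ q' d, g d = some q' → GoodMove A.priority W h q') ∧
      (A.δ r (letter v h)).Sat (fun q' d => g d = some q') := by
    intro v h
    by_cases hI : Inv h
    · rcases h with _ | ⟨r, h⟩
      · exact (hI.2.1 rfl).elim
      · obtain ⟨g, h1, h2⟩ := (hA r _).exists_choice
          (hW v r h hI.1 (hI.2.2 _ (List.suffix_refl _) (by simp)))
        exact ⟨g, fun _ => ⟨r, rfl, fun q' d hd => (h1 q' d hd).1, h2⟩⟩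
    · exact ⟨fun _ => none, fun h => (hI h).elim⟩
  choose g hg using hg
  have hpush : ∀ {h q'}, Inv h → GoodMove A.priority W h q' → Inv (push q' h) := by
    intro h q' hI hm
    refine ⟨nodup_push hI.1, fun h0 => ?_, fun h' h1 h2 => ?_⟩
    · have := head?_push (q := q') hI.1
      rw [h0] at this
      simp at this
    · by_cases hmem : q' ∈ h
      · exact hI.2.2 h' (h1.trans (push_suffix hmem)) h2
      · rw [push, if_neg hmem, List.suffix_cons_iff] at h1
        rcases h1 with rfl | h1
        · rwa [GoodMove, if_neg hmem] at hm
        · exact hI.2.2 h' h1 h2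
  let L : List Dir → Option (List Q) := unfold
    (fun v x d => x.bind fun h => (g v h d).map fun q' => push q' h) (some [q])
  have hL : ∀ v d h', L (v ++ [d]) = some h' ↔
      ∃ h, L v = some h ∧ ∃ q', g v h d = some q' ∧ push q' h = h' := by
    intro v d h'
    simp only [L, unfold_concat, Option.bind_eq_some_iff, Option.map_eq_some_iff]
  have hInv : ∀ v h, L v = some h → Inv h := by
    intro v
    induction v using List.reverseRecOn with
    | nil =>
      intro h hh
      obtain rfl : [q] = h := by simpa [L] using hh
      refine ⟨by simp, by simp, fun h' h1 h2 => ?_⟩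
      rw [List.suffix_cons_iff, List.suffix_nil] at h1
      exact h1.resolve_right h2 ▸ hq
    | append_singleton v d ih =>
      intro h' hh
      obtain ⟨h, h1, q', h2, rfl⟩ := (hL v d h').1 hh
      obtain ⟨r, -, h3, -⟩ := hg v h (ih h h1)
      exact hpush (ih h h1) (h3 q' d h2)
  refine ⟨fun v => letter v ((L v).getD []), ?_, fun v => (L v).getD [], fun v => rfl⟩
  refine IsRun.mem_lang (ρ := fun v => (L v).bind List.head?) ⟨rfl, fun v p hv => ?_,
    fun v π s hs => ?_⟩
  · obtain ⟨h, h1, h2⟩ := Option.bind_eq_some_iff.1 hv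
    obtain ⟨r, h3, -, h4⟩ := hg v h (hInv v h h1)
    obtain rfl : r = p := by rw [h2] at h3; exact (Option.some.inj h3).symm
    simp only [h1, Option.getD_some]
    refine h4.mono fun q' d hd => ?_
    rw [(hL v d _).2 ⟨h, h1, q', hd, rfl⟩]
    exact head?_push (hInv v h h1).1
  · choose h h1 h2 using fun k => Option.bind_eq_some_iff.1 (hs k)
    have hstep : ∀ k, h (k + 1) = push (s (k + 1)) (h k) ∧
        GoodMove A.priority W (h k) (s (k + 1)) := by
      intro k
      have h3 := h1 (k + 1)
      rw [pre_succ, ← List.append_assoc, hL] at h3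
      obtain ⟨h', h4, q', h5, h6⟩ := h3
      obtain rfl : h k = h' := Option.some.inj ((h1 k).symm.trans h4)
      have hI := hInv _ _ (h1 k)
      have h7 := head?_push (q := q') hI.1
      rw [h6, h2 (k + 1), Option.some.injEq] at h7
      obtain ⟨r, -, h8, -⟩ := hg _ _ hI
      exact ⟨by rw [h7, h6], h7 ▸ h8 q' _ h5⟩
    refine evenLiminf_of_stack (h := h) (hInv _ _ (h1 0)).1 (fun k => (hstep k).1) fun k hk => ?_
    have := (hstep k).2
    rwa [GoodMove, if_pos hk] at this

/-- If `W [q]` holds, `∃` can play by stacks on any given tree. If not, each stack outside `W` has a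
letter on which she has no good move; for the dual automaton, whose priorities are shifted by one,
this is a strategy for the complement of `W`, and it yields a tree that `A` rejects. -/
theorem lang_eq_univ_iff_of_stack [Fintype Q] [DecidableEq Q] (hA : A.IsGame) {W : List Q → Prop}
    (hW : ∀ r h, (r :: h).Nodup → (W (r :: h) ↔
      ∀ a, (A.δ r a).Sat fun q' _ => GoodMove A.priority W (r :: h) q')) (q : Q) :
    W [q] ↔ A.lang q = Set.univ := by
  constructor
  · intro hq
    refine Set.eq_univ_of_forall fun t => ?_
    obtain ⟨t', ht', st, h⟩ := exists_mem_lang_of_stack hA.isLinear (fun v _ => t v) hq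
      fun v r h hn hr => (hW r h hn).1 hr (t v)
    rwa [show t' = t from funext h] at ht'
  · intro huniv
    by_contra hq
    -- Without letters the condition on `[q]` holds vacuously.
    have hΛ : Nonempty Λ := by
      by_contra hΛ
      exact hq ((hW q [] (by simp)).2 fun a => (hΛ ⟨a⟩).elim)
    have hl : ∀ h : List Q, ∃ a, ∀ r h', h = r :: h' → h.Nodup → ¬W h →
        ¬(A.δ r a).Sat fun q' _ => GoodMove A.priority W h q' := by
      rintro (_ | ⟨r, h⟩)
      · exact ⟨hΛ.some, fun r h' e => by simp at e⟩
      · by_cases hr : (r :: h).Nodup ∧ ¬W (r :: h)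
        · have h1 := hr.2
          rw [hW r h hr.1] at h1
          push Not at h1
          obtain ⟨a, ha⟩ := h1
          refine ⟨a, fun r' h' e _ _ => ?_⟩
          injection e with e1 e2
          exact e1 ▸ ha
        · exact ⟨hΛ.some, fun _ _ _ h1 h2 => (hr ⟨h1, h2⟩).elim⟩
    choose l hl using hl
    obtain ⟨t, ht, -⟩ := exists_mem_lang_of_stack (A := A.dual) hA.dual.isLinear
      (W := fun h => ¬W h) (fun _ h => l h) hq fun v r h hn hr => by
        refine (Formula.sat_dual.2 (hl _ r h rfl hn hr)).mono fun q' _ hq' => ?_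
        unfold GoodMove at hq' ⊢
        split_ifs at hq' ⊢ with hmem
        · change Even (segMin (fun x => A.priority x + 1) q' (r :: h))
          rw [segMin_succ hmem]
          exact Nat.even_add_one.2 hq'
        · exact hq'
    exact notMem_lang_of_mem_dual hA ht (huniv ▸ trivial)

end Automaton

/-! ## The algorithm -/

/-- The rows of a finite presentation. -/
abbrev Rows : Type := List (ℕ × List (List ℕ))

/-- The row of the state `r`. -/
def rowOf (R : Rows) (r : ℕ) : ℕ × List (List ℕ) := R.getD r (0, [])

/-- Satisfaction of the code of a transition of a game automaton by a set of states. -/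
def evalCode (g : ℕ → Bool) (c : List ℕ) : Bool :=
  if c.getD 0 0 = 0 then true
  else if c.getD 0 0 = 1 then false
  else if c.getD 0 0 = 4 then g (c.getD 2 0) || g (c.getD 4 0)
  else if c.getD 0 0 = 5 then g (c.getD 2 0) && g (c.getD 4 0)
  else g (c.getD 1 0)

/-- Whether `∃` wins from the stack `h` within `k` moves if `∀` chooses the letters and the play is
decided by the first cycle. -/
def winCode (R : Rows) : ℕ → List ℕ → Bool
  | 0, _ => false
  | k + 1, h => decide (∀ c ∈ (rowOf R (h.getD 0 0)).2, evalCode (fun q =>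
      if q ∈ h then decide (segMin (fun x => (rowOf R x).1) q h % 2 = 0)
      else if q < R.length then winCode R k (q :: h) else false) c = true)

/-- Whether the state `r` accepts all trees. -/
def univCode (R : Rows) (r : ℕ) : Bool := winCode R R.length [r]

/-- The code of the transition of the strategy automaton from the state `r` with a letter whose
second component is `L`, `R` or `⋆`, respectively, for `x = 0, 1, 2`. -/
def stratCode (R : Rows) (r : ℕ) (x : ℕ) (c : List ℕ) : List ℕ :=
  if univCode R r = true then [0]
  else if c.getD 0 0 = 1 then [1]
  else if c.getD 0 0 = 4 then
    if (univCode R (c.getD 2 0) || univCode R (c.getD 4 0)) = true then [0]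
    else if x = 0 then [2, c.getD 2 0]
    else if x = 1 then [3, c.getD 4 0]
    else [1]
  else if x = 2 then c
  else [1]

/-- The presentation of the strategy automaton. -/
def stratAutCode (C : AutCode) : AutCode :=
  (3 * C.1, C.2.1, (List.range C.2.2.length).map fun r =>
    ((rowOf C.2.2 r).1, (rowOf C.2.2 r).2.flatMap fun c =>
      [stratCode C.2.2 r 0 c, stratCode C.2.2 r 1 c, stratCode C.2.2 r 2 c]))

/-! ### Computability -/

section Primrec

open Primrec

variable {α : Type} [Primcodable α]

theorem primrec_rowOf {f : α → Rows} {g : α → ℕ} (hf : Primrec f) (hg : Primrec g) :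
    Primrec fun a => rowOf (f a) (g a) := (list_getD _).comp hf hg

theorem primrec_getD {f : α → List ℕ} (hf : Primrec f) (k : ℕ) :
    Primrec fun a => (f a).getD k 0 := (list_getD 0).comp hf (Primrec.const k)

theorem primrec_evalCode {g : α → ℕ → Bool} {c : α → List ℕ} (hg : Primrec₂ g) (hc : Primrec c) :
    Primrec fun a => evalCode (g a) (c a) := by
  have hk : ∀ k, PrimrecPred fun a => (c a).getD 0 0 = k := fun k =>
    Primrec.eq.comp (primrec_getD hc 0) (Primrec.const k)
  have hgk : ∀ k, Primrec fun a => g a ((c a).getD k 0) := fun k =>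
    hg.comp Primrec.id (primrec_getD hc k)
  exact Primrec.ite (hk 0) (Primrec.const true) (Primrec.ite (hk 1) (Primrec.const false)
    (Primrec.ite (hk 4) (Primrec.or.comp (hgk 2) (hgk 4))
      (Primrec.ite (hk 5) (Primrec.and.comp (hgk 2) (hgk 4)) (hgk 1))))

theorem primrecPred_mem {f : α → ℕ} {g : α → List ℕ} (hf : Primrec f) (hg : Primrec g) :
    PrimrecPred fun a => f a ∈ g a :=
  ((Primrec.eq.exists_mem_list).comp hg hf).of_eq fun a => by simp

theorem primrec_segMin {pr : α → ℕ → ℕ} {f : α → ℕ} {g : α → List ℕ} (hp : Primrec₂ pr)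
    (hf : Primrec f) (hg : Primrec g) : Primrec fun a => segMin (pr a) (f a) (g a) := by
  have h : Primrec₂ fun (a : α) (x : ℕ × ℕ) => if x.1 = f a then pr a x.1 else
      min (pr a x.1) x.2 :=
    Primrec.ite (Primrec.eq.comp (fst.comp snd) (hf.comp fst))
      (hp.comp fst (fst.comp snd))
      (nat_min.comp (hp.comp fst (fst.comp snd)) (snd.comp snd))
  refine (list_foldr hg (Primrec.const 0) h).of_eq fun a => ?_
  induction g a with
  | nil => rfl
  | cons x l ih => rw [List.foldr_cons, ih]; rfl

/-- The fuel is tied to the stack: it drops by one with each push, so it serves as a measure for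
recursion. The successors `q :: h` are listed in the order of `q`, so the list of their values can
be indexed by `q`. -/
theorem primrec_winCode :
    Primrec₂ fun (R : Rows) (h : List ℕ) => winCode R (R.length + 1 - h.length) h := by
  have hlen : Primrec₂ fun (R : Rows) (h : List ℕ) => R.length + 1 - h.length :=
    nat_sub.comp (succ.comp (list_length.comp fst)) (list_length.comp snd)
  have hle : PrimrecRel fun (R : Rows) (h : List ℕ) => h.length ≤ R.length :=
    nat_le.comp (list_length.comp snd) (list_length.comp fst)
  have hmove : Primrec₂ fun (a : (List ℕ × Rows × List ℕ × List Bool)) (q : ℕ) =>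
      if q ∈ a.2.2.1 then
        decide (segMin (fun x => (rowOf a.2.1 x).1) q a.2.2.1 % 2 = 0)
      else a.2.2.2.getD q false := by
    have hh : Primrec fun x : (List ℕ × Rows × List ℕ × List Bool) × ℕ => x.1.2.2.1 :=
      fst.comp (snd.comp (snd.comp fst))
    refine Primrec.ite (primrecPred_mem snd hh) ?_ ((list_getD false).comp
      (snd.comp (snd.comp (snd.comp fst))) snd)
    refine PrimrecPred.decide (Primrec.eq.comp (nat_mod.comp (primrec_segMin ?_ snd hh)
      (Primrec.const 2)) (Primrec.const 0))
    exact fst.comp (primrec_rowOf (fst.comp (snd.comp (fst.comp fst))) snd)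
  have hall : PrimrecRel fun (c : List ℕ) (a : Rows × List ℕ × List Bool) =>
      evalCode (fun q => if q ∈ a.2.1 then
        decide (segMin (fun x => (rowOf a.1 x).1) q a.2.1 % 2 = 0)
      else a.2.2.getD q false) c = true :=
    Primrec.eq.comp (primrec_evalCode hmove fst) (Primrec.const true)
  refine nat_omega_rec (m := fun R h => R.length + 1 - h.length)
    (l := fun R h => if h.length ≤ R.length then (List.range R.length).map (· :: h) else [])
    (g := fun R x => some (if x.1.length ≤ R.length then
      decide (∀ c ∈ (rowOf R (x.1.getD 0 0)).2, evalCode (fun q => if q ∈ x.1 then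
        decide (segMin (fun x => (rowOf R x).1) q x.1 % 2 = 0)
      else x.2.getD q false) c = true) else false))
    _ hlen ?_ ?_ ?_ ?_
  · exact Primrec.ite hle (list_map (list_range.comp (list_length.comp fst))
      (list_cons.comp snd (snd.comp fst))) (Primrec.const [])
  · refine option_some.comp (Primrec.ite (hle.comp fst (fst.comp snd)) ?_ (Primrec.const false))
    exact PrimrecPred.decide ((hall.forall_mem_list).comp
      (snd.comp (primrec_rowOf fst (primrec_getD (fst.comp snd) 0))) Primrec.id)
  · intro R h b hb
    split_ifs at hb with hl
    · obtain ⟨q, -, rfl⟩ := List.mem_map.1 hb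
      simp only [List.length_cons]
      omega
    · simp at hb
  · intro R h
    by_cases hl : h.length ≤ R.length
    · simp only [if_pos hl]
      obtain ⟨k, hk⟩ : ∃ k, R.length + 1 - h.length = k + 1 := ⟨R.length - h.length, by omega⟩
      have hk' : ∀ q, R.length + 1 - (q :: h).length = k := fun q => by
        simp only [List.length_cons]; omega
      rw [hk, winCode]
      congr 1
      congr 1
      refine propext (forall₂_congr fun c _ => ?_)
      have : ∀ q, (((List.range R.length).map (· :: h)).map fun h =>
          winCode R (R.length + 1 - h.length) h).getD q false =
          if q < R.length then winCode R k (q :: h) else false := by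
        intro q
        by_cases hq : q < R.length
        · simp [List.getD_eq_getElem?_getD, hq, ← hk' q]
        · simp [List.getD_eq_getElem?_getD, hq]
      simp only [this]
    · have : R.length + 1 - h.length = 0 := by omega
      simp only [if_neg hl, this, winCode]

theorem primrec_univCode {f : α → Rows} {g : α → ℕ} (hf : Primrec f) (hg : Primrec g) :
    Primrec fun a => univCode (f a) (g a) :=
  primrec_winCode.comp hf (list_cons.comp hg (Primrec.const []))

theorem primrec_stratCode (x : ℕ) {f : α → Rows} {g : α → ℕ} {c : α → List ℕ} (hf : Primrec f)
    (hg : Primrec g) (hc : Primrec c) : Primrec fun a => stratCode (f a) (g a) x (c a) := by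
  have hk : ∀ k, PrimrecPred fun a => (c a).getD 0 0 = k := fun k =>
    Primrec.eq.comp (primrec_getD hc 0) (Primrec.const k)
  have hx : ∀ k, PrimrecPred fun _ : α => x = k := fun k =>
    Primrec.eq.comp (Primrec.const x) (Primrec.const k)
  have hu : ∀ {g : α → ℕ}, Primrec g → Primrec fun a => univCode (f a) (g a) :=
    fun hg => primrec_univCode hf hg
  have hpair : ∀ k l, Primrec fun a => [k, (c a).getD l 0] := fun k l =>
    list_cons.comp (Primrec.const k) (list_cons.comp (primrec_getD hc l) (Primrec.const []))
  exact Primrec.ite (Primrec.eq.comp (hu hg) (Primrec.const true)) (Primrec.const [0])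
    (Primrec.ite (hk 1) (Primrec.const [1])
      (Primrec.ite (hk 4)
        (Primrec.ite (Primrec.eq.comp (Primrec.or.comp (hu (primrec_getD hc 2))
            (hu (primrec_getD hc 4))) (Primrec.const true)) (Primrec.const [0])
          (Primrec.ite (hx 0) (hpair 2 2) (Primrec.ite (hx 1) (hpair 3 4) (Primrec.const [1]))))
        (Primrec.ite (hx 2) hc (Primrec.const [1]))))

theorem primrec_stratAutCode : Primrec stratAutCode := by
  have hR : Primrec fun C : AutCode => C.2.2 := snd.comp snd
  refine Primrec.pair (nat_mul.comp (Primrec.const 3) fst) (Primrec.pair (fst.comp snd) ?_)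
  refine list_map (list_range.comp (list_length.comp hR)) ?_
  have hrow : Primrec fun x : AutCode × ℕ => rowOf x.1.2.2 x.2 :=
    primrec_rowOf (hR.comp fst) snd
  refine Primrec.pair (fst.comp hrow) (list_flatMap (snd.comp hrow) ?_)
  have hs : ∀ k, Primrec fun x : (AutCode × ℕ) × List ℕ => stratCode x.1.1.2.2 x.1.2 k x.2 :=
    fun k => primrec_stratCode k (hR.comp (fst.comp fst)) (snd.comp fst) snd
  exact list_cons.comp (hs 0) (list_cons.comp (hs 1) (list_cons.comp (hs 2) (Primrec.const [])))

end Primrec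

/-! ### Correctness -/

/-- Branching transitions have codes `[4, 2, q, 3, r]` and `[5, 2, q, 3, r]`, so the states are at
positions `2` and `4`; in an atom the state is at position `1`. -/
theorem Formula.IsGame.evalCode_iff {n : ℕ} {b : Formula (Fin n)} (hb : b.IsGame) {g : ℕ → Bool} :
    evalCode g b.code = true ↔ b.Sat fun (q : Fin n) _ => g q = true := by
  rcases hb with rfl | rfl | ⟨q, _ | _, rfl⟩ | ⟨q, r, rfl⟩ | ⟨q, r, rfl⟩ <;>
    simp [evalCode, Formula.code, Formula.Sat, Formula.orLR, Formula.andLR]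

namespace Automaton

variable {m n : ℕ} {A : Automaton (Fin m) (Fin n)}

/-- The rows of the presentation of an automaton. -/
abbrev rows (A : Automaton (Fin m) (Fin n)) : Rows :=
  List.ofFn fun r => (A.priority r, (List.finRange m).map fun a => (A.δ r a).code)

theorem rowOf_rows (r : Fin n) :
    rowOf A.rows r = (A.priority r, (List.finRange m).map fun a => (A.δ r a).code) := by
  simp [rowOf, rows, List.getD_eq_getElem?_getD]

/-- A stack without repetitions has at most `n` entries, so the fuel `n + 1 - h.length` is positive
on it and one unfolding of `winCode` is the equation required by `lang_eq_univ_iff_of_stack`. -/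
theorem univCode_rows_iff (hA : A.IsGame) (q : Fin n) :
    univCode A.rows q = true ↔ A.lang q = Set.univ := by
  have hlen : A.rows.length = n := by simp [rows]
  rw [← lang_eq_univ_iff_of_stack hA
    (W := fun h => winCode A.rows (n + 1 - h.length) (h.map Fin.val) = true)]
  · simp [univCode, hlen]
  · intro r h hn
    have hle : h.length + 1 ≤ n := by simpa using hn.length_le_card
    obtain ⟨k, hk⟩ : ∃ k, n + 1 - (r :: h).length = k + 1 := ⟨n - (r :: h).length, by
      simp only [List.length_cons]; omega⟩
    have hk' : ∀ q : Fin n, n + 1 - (q :: r :: h).length = k := fun q => by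
      simp only [List.length_cons] at hk ⊢; omega
    rw [hk, winCode, decide_eq_true_iff]
    simp only [List.map_cons, List.getD_cons_zero, rowOf_rows, List.forall_mem_map,
      List.mem_finRange, true_imp_iff]
    refine forall_congr' fun a => ?_
    rw [(hA r a).evalCode_iff]
    have hgood : ∀ q' : Fin n, ((if (q' : ℕ) ∈ (r : ℕ) :: h.map Fin.val then
        decide (segMin (fun x => (rowOf A.rows x).1) (q' : ℕ) ((r : ℕ) :: h.map Fin.val) % 2 = 0)
        else if (q' : ℕ) < A.rows.length then
          winCode A.rows k ((q' : ℕ) :: (r : ℕ) :: h.map Fin.val) else false) = true) ↔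
        GoodMove A.priority (fun h => winCode A.rows (n + 1 - h.length) (h.map Fin.val) = true)
          (r :: h) q' := by
      intro q'
      have hmem : (q' : ℕ) ∈ (r : ℕ) :: h.map Fin.val ↔ q' ∈ r :: h := by
        rw [← List.map_cons, List.mem_map_of_injective Fin.val_injective]
      have hseg : segMin (fun x => (rowOf A.rows x).1) (q' : ℕ) ((r : ℕ) :: h.map Fin.val) =
          segMin A.priority q' (r :: h) := by
        rw [← List.map_cons]
        exact segMin_map Fin.val_injective (fun x => by rw [rowOf_rows]) q' (r :: h)
      rw [GoodMove, hseg, hk']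
      by_cases hq : q' ∈ r :: h
      · rw [if_pos (hmem.2 hq), if_pos hq, decide_eq_true_iff, Nat.even_iff]
      · rw [if_neg (fun h => hq (hmem.1 h)), if_neg hq, hlen, if_pos q'.2]
        rfl
    simp only [hgood]

theorem code_strat (hA : A.IsGame) (r : Fin n) (a : Fin m) (x : Option Dir) :
    ((A.strat fun q => univCode A.rows q).δ r (a, x)).code =
      stratCode A.rows r (match x with | some .L => 0 | some .R => 1 | none => 2)
        (A.δ r a).code := by
  simp only [strat, Formula.strat, stratCode]
  by_cases hr : univCode A.rows r = true
  · simp [hr, Formula.code]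
  · simp only [if_neg hr]
    rcases hA r a with h | h | ⟨q, _ | _, h⟩ | ⟨q, q', h⟩ | ⟨q, q', h⟩ <;>
      rcases x with _ | _ | _ <;>
      simp [h, Formula.code, Formula.orLR, Formula.andLR, apply_ite Formula.code]

theorem stratAutCode_code (hA : A.IsGame) (q : Fin n) :
    stratAutCode (A.code (List.finRange m) q) =
      (A.strat fun q => univCode A.rows q).code (strategyLetters m) q := by
  have hlen : (strategyLetters m).length = 3 * m := by
    simp [strategyLetters, List.length_flatMap, mul_comm]
  have hlen' : A.rows.length = n := by simp [rows]
  have hrange : List.range n = (List.finRange n).map Fin.val := List.map_coe_finRange_eq_range.symm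
  refine Prod.ext ?_ (Prod.ext rfl ?_)
  · change 3 * (List.finRange m).length = (strategyLetters m).length
    rw [hlen, List.length_finRange]
  change (List.range A.rows.length).map _ = List.ofFn _
  rw [hlen', hrange, List.map_map, List.ofFn_eq_map]
  refine List.map_congr_left fun r _ => ?_
  change ((rowOf A.rows r).1, (rowOf A.rows r).2.flatMap fun c =>
      [stratCode A.rows r 0 c, stratCode A.rows r 1 c, stratCode A.rows r 2 c]) = _
  rw [rowOf_rows]
  refine Prod.ext rfl ?_
  simp only [strategyLetters, List.flatMap_map, List.map_flatMap, List.map_cons, List.map_nil,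
    code_strat hA]

end Automaton

end TreeAut

/-! ### The proposition -/

theorem mainTheorem6 :
    ∃ F : TreeAut.AutCode → TreeAut.AutCode, Computable F ∧
      ∀ (m n : ℕ) (A : TreeAut.Automaton (Fin m) (Fin n)) (q : Fin n), A.IsGame →
        ∃ (k : ℕ) (D : TreeAut.Automaton (Fin m × Option TreeAut.Dir) (Fin k)) (p : Fin k),
          F (A.code (List.finRange m) q) = D.code (TreeAut.strategyLetters m) p ∧
          D.IsDeterministic ∧
          (∀ i j : ℕ, TreeAut.NondetRecognizable (A.lang q) i j ↔
            TreeAut.NondetRecognizable (D.lang p) i j) ∧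
          ((∀ r, A.IsNontrivial r) → D.lang p = A.winningStrategies q) := by
  refine ⟨TreeAut.stratAutCode, TreeAut.primrec_stratAutCode.to_comp, fun m n A q hA => ?_⟩
  have hU := TreeAut.Automaton.univCode_rows_iff hA
  refine ⟨n, A.strat fun q => TreeAut.univCode A.rows q, q,
    TreeAut.Automaton.stratAutCode_code hA q, hA.strat _,
    TreeAut.Automaton.nondetRecognizable_iff_strat hA hU q, fun hnt => ?_⟩
  refine TreeAut.Automaton.lang_strat_eq_winningStrategies hA (fun r => ?_) q
  rw [← Bool.not_eq_true, hU]
  exact (hnt r).2
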